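/- **Theorem (DShapley of linear regression with Gaussian inputs).** Let $(X,Y)$ be a pair of random variables with values in $\mathbb R^p\times\mathbb R$ and joint law $P_{X,Y}$, such that $\mathbb E[Y^2]<\infty$, $\mathbb E[Y\mid X]=X^T\beta$, $\mathrm{Var}(Y\mid X)=\sigma^2$ and $X\sim\mathcal N_p(0,\Sigma_X)$ with $\Sigma_X$ positive definite. For a data set $S$ of finitely many points $(x_i,y_i)\in\mathbb R^p\times\mathbb R$ with design matrix $X_S$ (rows $x_i^T$) and output vector $Y_S$, let $\hat\beta_{S}=(X_S^TX_S)^{-1}X_S^TY_S$ be the least squares estimator. For $q\in\mathbb N$ and $C_{\mathrm{lin}}\in\mathbb R$ define the utility $$U_{q,0}(S)=\Big(C_{\mathrm{lin}}-\int (y-x^T\hat\beta_S)^2\,dP_{X,Y}(x,y)\Big)\mathbf 1(|S|\ge q).$$ For a data set $B$ of size $m$ and $z^*\in B$, the data Shapley value is $$\phi(z^*;U,B)=\frac1m\sum_{j=1}^m\binom{m-1}{j-1}^{-1}\sum_{S\subseteq B\setminus\{z^*\},\,|S|=j-1}\big(U(S\cup\{z^*\})-U(S)\big),$$ and the distributional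 Shapley value (DShapley) of a point $z^*$ is $\nu(z^*;U,P_{X,Y},m)=\mathbb E_{B}\big[\phi(z^*;U,B\cup\{z^*\})\big]$, where $B$ consists of $m-1$ independent points with law $P_{X,Y}$. Let $m\ge1$ and $q\ge p+3$. Then there is a constant $C_{\mathrm{lin}}\in\mathbb R$, not depending on the point to be valued, such that for every $(x^*,y^*)\in\mathbb R^p\times\mathbb R$, with $e^*=y^*-x^{*T}\beta$, $$\nu\big((x^*,y^*);U_{q,0},P_{X,Y},m\big)=-\frac1m\sum_{j=q-1}^{m-1}\mathbb E\left[\frac{j-1}{j-p}\,\frac{x^{*T}\Sigma_X^{-1}x^*\,e^{*2}+T_j\sigma^2}{\big(x^{*T}\Sigma_X^{-1}x^*+T_j\big)^2}\right],\qquad T_j\sim\chi^2_{j-p+1},$$ where all the expectations (including the one that defines $\nu$) are of integrable variables. In particular, for this choice of $C_{\mathrm{lin}}$, two points with the same squared Mahalanobis distance $x^{*T}\Sigma_X^{-1}x^*$ and the same squared error $e^{*2}$ have the same DShapley. -/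

import Mathlib

open MeasureTheory ProbabilityTheory Matrix

noncomputable section

namespace DShapley

/-! ### Shapley values of data -/

/-- A utility function on finite data sets, that is a real function on the union of
the powers `Z ^ n`. -/
abbrev Utility (Z : Type*) : Type _ := (n : ℕ) → (Fin n → Z) → ℝ

/-- The marginal contribution `U (S ∪ {z}) - U S` of a point `z` to a data set `S`. -/
def marginal {Z : Type*} (U : Utility Z) (z : Z) {n : ℕ} (S : Fin n → Z) : ℝ :=
  U (n + 1) (Fin.snoc S z) - U n S

/-- The data Shapley value of the `i`-th point of the data set `B = (B 0, …, B (m - 1))`: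
the inner sum runs over all subsets of size `j - 1` of the data set without its `i`-th point. -/
def dataShapley {Z : Type*} (U : Utility Z) {m : ℕ} (B : Fin m → Z) (i : Fin m) : ℝ :=
  (1 / (m : ℝ)) * ∑ j ∈ Finset.Icc 1 m, (1 / ((m - 1).choose (j - 1) : ℝ)) *
    ∑ S ∈ Finset.powersetCard (j - 1) (Finset.univ.erase i),
      marginal U (B i) (B ∘ S.orderEmbOfFin rfl)

/-- The data Shapley value of `z` in the data set `B ∪ {z}`, where `B` has `k` points. -/
def dataShapleyInsert {Z : Type*} (U : Utility Z) (z : Z) {k : ℕ} (B : Fin k → Z) : ℝ :=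
  dataShapley U (Fin.snoc B z : Fin (k + 1) → Z) (Fin.last k)

/-- The distributional Shapley value of `z` (for `1 ≤ m`): the expected data Shapley value of `z`
in a data set consisting of `z` and of `m - 1` independent points with law `P`. -/
def dShapley {Z : Type*} [MeasurableSpace Z] (U : Utility Z) (P : Measure Z) (m : ℕ) (z : Z) : ℝ :=
  ∫ B : Fin (m - 1) → Z, dataShapleyInsert U z B ∂(Measure.pi fun _ => P)

/-! ### Linear regression -/

/-- Points `(x, y)` with input `x` in `ℝ ^ p` and real output `y`. -/
abbrev Point (p : ℕ) : Type := EuclideanSpace ℝ (Fin p) × ℝ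

/-- The design matrix of a data set; its rows are the inputs. -/
def designMatrix {p n : ℕ} (S : Fin n → Point p) : Matrix (Fin n) (Fin p) ℝ :=
  Matrix.of fun i k => (S i).1 k

/-- The output vector of a data set. -/
def outputVector {p n : ℕ} (S : Fin n → Point p) : Fin n → ℝ := fun i => (S i).2

/-- The ridge regression estimator `(Xᵀ X + γ I)⁻¹ Xᵀ Y`; for `γ = 0` it is the least squares
estimator. -/
def ridgeEstimator {p n : ℕ} (γ : ℝ) (S : Fin n → Point p) : EuclideanSpace ℝ (Fin p) :=
  WithLp.toLp 2 (((designMatrix S)ᵀ * designMatrix S + γ • (1 : Matrix (Fin p) (Fin p) ℝ))⁻¹ *ᵥ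
    ((designMatrix S)ᵀ *ᵥ outputVector S))

/-- The utility of a data set `S`: the constant `C` minus the prediction risk under `P` of the
ridge estimator based on `S` if `S` has at least `q` points, and `0` otherwise. -/
def ridgeUtility {p : ℕ} (P : Measure (Point p)) (C : ℝ) (q : ℕ) (γ : ℝ) : Utility (Point p) :=
  fun n S =>
    if q ≤ n then C - ∫ z : Point p, (z.2 - inner ℝ z.1 (ridgeEstimator γ S)) ^ 2 ∂P else 0

/-- The squared Mahalanobis norm `xᵀ M⁻¹ x`. -/
def mahalanobis {p : ℕ} (M : Matrix (Fin p) (Fin p) ℝ) (x : EuclideanSpace ℝ (Fin p)) : ℝ :=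
  x.ofLp ⬝ᵥ (M⁻¹ *ᵥ x.ofLp)

/-- The chi-squared distribution with `k` degrees of freedom: the law of the sum of the squares of
`k` independent standard Gaussian variables. -/
def chiSquared (k : ℕ) : Measure ℝ :=
  (Measure.pi fun _ : Fin k => gaussianReal 0 1).map fun g => ∑ i, g i ^ 2

end DShapley

end

open MeasureTheory ProbabilityTheory Matrix

noncomputable section

namespace DShapley

/-! ### Laplace transform and inverse moment of the chi-squared law. -/

section

/-! Any `n` points selected from an i.i.d. sample are again i.i.d., so all subsets of one size have
the same expected marginal contribution and the binomial weights cancel. Hence `m` times the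
DShapley is the sum over `n < m` of the expected marginal contributions to `n` random points
(`integral_dataShapleyInsert`), and it remains to compute the expected drop of the risk when `(x,
y)` joins `n` random points.

Write `A` for the Gram matrix of the `n` inputs, `l = xᵀ A⁻¹ x` for the leverage, `u = Σ^(1/2) A⁻¹
x` for the influence, `e` for the error of the new point and `d` for its squared Mahalanobis norm.
The risk of `b` is `σ² + ‖Σ^(1/2) (b - β)‖²`, and the error of least squares is linear in the errors
of the data, which are uncorrelated given the inputs. Sherman-Morrison then gives the expected drop
as the mean of `‖u‖² (σ² (2 + l) - e²) / (1 + l)²` (`sum_norm_sq_weightInsert`,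
`integral_risk_snoc`).

The joint behaviour of `l` and `‖u‖²` is found by a linear change of variables that reduces to
standard Gaussian inputs and `x = √d e₁`. Regress the first column of the design matrix on the other
`p - 1`, with residual sum of squares `T` and coefficients `b`. Then `l = d / T` and `‖u‖² = d (1 +
‖b‖²) / T²`. Given the other columns, `T` is chi-squared with `n - p + 1` degrees of freedom and
independent of `b`. The mean of `1 + ‖b‖²` is one plus the expected trace of an inverse Wishart
matrix, that is `(n - 1) / (n - p)` (`lintegral_norm_sq_gramSolve_gaussRows`).

After this substitution the drop splits by partial fractions into a multiple of `σ² / T`, the same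
for all points, minus the term in the theorem. The means of the common terms are summed and absorbed
into the constant of the utility. All the moments are finite because `n ≥ q - 1 ≥ p + 2` leaves at
least three degrees of freedom. -/

lemma measurable_sum_sq (k : ℕ) : Measurable fun g : Fin k → ℝ => ∑ i, g i ^ 2 := by fun_prop

instance (k : ℕ) : IsProbabilityMeasure (chiSquared k) :=
  Measure.isProbabilityMeasure_map (measurable_sum_sq k).aemeasurable

/-- The Laplace transform of the square of a standard Gaussian variable. -/
lemma integral_exp_neg_mul_sq_gaussianReal {u : ℝ} (hu : 0 ≤ u) :
    ∫ g, Real.exp (-u * g ^ 2) ∂(gaussianReal 0 1) = (1 + 2 * u) ^ (-(1 / 2) : ℝ) := by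
  rw [integral_gaussianReal_eq_integral_smul one_ne_zero]
  have h : ∀ g : ℝ, gaussianPDFReal 0 1 g • Real.exp (-u * g ^ 2) =
      (√(2 * Real.pi))⁻¹ * Real.exp (-((1 + 2 * u) / 2) * g ^ 2) := by
    intro g
    rw [gaussianPDFReal, smul_eq_mul, mul_assoc, ← Real.exp_add]
    congr 2
    · simp
    · simp; ring
  simp_rw [h]
  rw [integral_const_mul, integral_gaussian, ← Real.sqrt_inv, ← Real.sqrt_mul (by positivity),
    Real.rpow_neg (by positivity), ← Real.sqrt_eq_rpow, ← Real.sqrt_inv]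
  congr 1
  have := Real.pi_pos
  field_simp

lemma lintegral_exp_neg_mul_chiSquared (k : ℕ) {u : ℝ} (hu : 0 ≤ u) :
    ∫⁻ t, ENNReal.ofReal (Real.exp (-u * t)) ∂(chiSquared k) =
      ENNReal.ofReal ((1 + 2 * u) ^ (-(k / 2) : ℝ)) := by
  rw [chiSquared, lintegral_map (by fun_prop) (measurable_sum_sq k)]
  have h : ∀ g : Fin k → ℝ, Real.exp (-u * ∑ i, g i ^ 2) = ∏ i, Real.exp (-u * g i ^ 2) := by
    intro g
    rw [← Real.exp_sum, Finset.mul_sum]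
  simp_rw [h]
  rw [← ofReal_integral_eq_lintegral_ofReal]
  · rw [integral_fintype_prod_eq_prod (f := fun _ x => Real.exp (-u * x ^ 2))]
    simp_rw [integral_exp_neg_mul_sq_gaussianReal hu]
    rw [Finset.prod_const, ← Real.rpow_natCast, ← Real.rpow_mul (by positivity)]
    congr 2
    simp; ring
  · refine Integrable.of_bound (C := 1)
      (Measurable.aestronglyMeasurable (by fun_prop)) (.of_forall fun g => ?_)
    rw [← h, Real.norm_eq_abs, abs_of_pos (Real.exp_pos _), Real.exp_le_one_iff]
    have : 0 ≤ ∑ i, g i ^ 2 := Finset.sum_nonneg fun i _ => sq_nonneg _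
    nlinarith
  · exact .of_forall fun g => Finset.prod_nonneg fun i _ => (Real.exp_pos _).le

lemma chiSquared_pos_ae {k : ℕ} (hk : 1 ≤ k) : ∀ᵐ t ∂(chiSquared k), 0 < t := by
  rw [chiSquared, ae_map_iff (measurable_sum_sq k).aemeasurable measurableSet_Ioi]
  have h0 : ∀ᵐ x ∂(gaussianReal 0 1), x ≠ 0 := by
    have := nullSingletonClass_gaussianReal (μ := 0) (v := 1) one_ne_zero
    simp [ae_iff]
  have h1 : ∀ᵐ g ∂(Measure.pi fun _ : Fin k => gaussianReal 0 1), g ⟨0, hk⟩ ≠ 0 :=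
    (measurePreserving_eval (fun _ : Fin k => gaussianReal 0 1) ⟨0, hk⟩).quasiMeasurePreserving.ae h0
  filter_upwards [h1] with g hg
  exact Finset.sum_pos' (fun i _ => sq_nonneg _) ⟨_, Finset.mem_univ _, by positivity⟩

lemma lintegral_Ioi_exp_neg_mul {t : ℝ} (ht : 0 < t) :
    ∫⁻ u in Set.Ioi (0 : ℝ), ENNReal.ofReal (Real.exp (-u * t)) = ENNReal.ofReal (1 / t) := by
  have h : ∀ u : ℝ, -u * t = -t * u := fun u => by ring
  simp_rw [h]
  rw [← ofReal_integral_eq_lintegral_ofReal (integrableOn_exp_mul_Ioi (by linarith) 0)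
    (.of_forall fun u => (Real.exp_pos _).le), integral_exp_mul_Ioi (by linarith)]
  simp

lemma lintegral_Ioi_one_add_two_mul_rpow {a : ℝ} (ha : 1 < a) :
    ∫⁻ u in Set.Ioi (0 : ℝ), ENNReal.ofReal ((1 + 2 * u) ^ (-a)) =
      ENNReal.ofReal (1 / (2 * (a - 1))) := by
  have hd : ∀ u ∈ Set.Ici (0 : ℝ), HasDerivAt (fun u : ℝ => -(1 + 2 * u) ^ (1 - a) / (2 * (a - 1)))
      ((1 + 2 * u) ^ (-a)) u := by
    intro u hu
    have hu' : (0 : ℝ) < 1 + 2 * u := by have : (0 : ℝ) ≤ u := hu; positivity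
    have h1 : HasDerivAt (fun u : ℝ => 1 + 2 * u) 2 u := by
      simpa using ((hasDerivAt_id u).const_mul 2).const_add 1
    have h2 := ((h1.rpow_const (p := 1 - a) (Or.inl hu'.ne')).neg).div_const (2 * (a - 1))
    have h3 : -(2 * (1 - a) * (1 + 2 * u) ^ (1 - a - 1)) / (2 * (a - 1)) =
        (1 + 2 * u) ^ (-a) := by
      rw [show 1 - a - 1 = -a by ring, div_eq_iff (by linarith)]
      ring
    exact h3 ▸ h2
  have ht : Filter.Tendsto (fun u : ℝ => -(1 + 2 * u) ^ (1 - a) / (2 * (a - 1))) Filter.atTop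
      (nhds 0) := by
    have h1 : Filter.Tendsto (fun u : ℝ => 1 + 2 * u) Filter.atTop Filter.atTop :=
      Filter.tendsto_atTop_add_const_left _ _ (Filter.tendsto_id.const_mul_atTop two_pos)
    have h2 := (tendsto_rpow_neg_atTop (y := a - 1) (by linarith)).comp h1
    have h3 := h2.neg.div_const (2 * (a - 1))
    simpa [Function.comp_def] using h3
  have hn : ∀ u ∈ Set.Ioi (0 : ℝ), 0 ≤ (1 + 2 * u) ^ (-a) := fun u hu =>
    Real.rpow_nonneg (by have : (0 : ℝ) < u := hu; positivity) _
  rw [← ofReal_integral_eq_lintegral_ofReal (integrableOn_Ioi_deriv_of_nonneg' hd hn ht)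
    ((ae_restrict_iff' measurableSet_Ioi).2 (.of_forall hn)),
    integral_Ioi_of_hasDerivAt_of_nonneg' hd hn ht]
  congr 1
  simp [neg_div]

/-- The expectation of the inverse of a chi-squared variable. -/
lemma lintegral_inv_chiSquared {k : ℕ} (hk : 3 ≤ k) :
    ∫⁻ t, ENNReal.ofReal (1 / t) ∂(chiSquared k) = ENNReal.ofReal (1 / (k - 2)) := by
  have hk' : (3 : ℝ) ≤ k := by exact_mod_cast hk
  -- Since `1 / t = ∫ exp (-u t) du` over `u > 0`, Tonelli turns the moment into the integral of the
  -- Laplace transform, which converges because `k / 2 > 1`.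
  calc ∫⁻ t, ENNReal.ofReal (1 / t) ∂(chiSquared k)
      = ∫⁻ t, (∫⁻ u in Set.Ioi (0 : ℝ), ENNReal.ofReal (Real.exp (-u * t))) ∂(chiSquared k) := by
        refine lintegral_congr_ae ?_
        filter_upwards [chiSquared_pos_ae (by lia : 1 ≤ k)] with t ht
        rw [lintegral_Ioi_exp_neg_mul ht]
    _ = ∫⁻ u in Set.Ioi (0 : ℝ), ∫⁻ t, ENNReal.ofReal (Real.exp (-u * t)) ∂(chiSquared k) :=
        lintegral_lintegral_swap (Measurable.aemeasurable (by fun_prop))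
    _ = ∫⁻ u in Set.Ioi (0 : ℝ), ENNReal.ofReal ((1 + 2 * u) ^ (-(k / 2) : ℝ)) :=
        setLIntegral_congr_fun measurableSet_Ioi fun u hu =>
          lintegral_exp_neg_mul_chiSquared k (le_of_lt hu)
    _ = ENNReal.ofReal (1 / (k - 2)) := by
        rw [lintegral_Ioi_one_add_two_mul_rpow (by linarith)]
        congr 2
        ring

lemma integrable_inv_chiSquared {k : ℕ} (hk : 3 ≤ k) :
    Integrable (fun t : ℝ => 1 / t) (chiSquared k) := by
  refine ⟨by fun_prop, ?_⟩
  rw [hasFiniteIntegral_iff_ofReal, lintegral_inv_chiSquared hk]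
  · exact ENNReal.ofReal_lt_top
  · filter_upwards [chiSquared_pos_ae (by lia : 1 ≤ k)] with t ht
    simp only [Pi.zero_apply]; positivity

end

/-! ### Orthogonal projections of Gaussian vectors, and splitting off a column. -/

section

/-- Under the standard Gaussian law, the projections onto a subspace and onto its orthogonal
complement are independent, and the squared norm of the latter is a chi-squared variable. -/
lemma map_norm_sq_sub_starProjection_stdGaussian {E : Type*} [NormedAddCommGroup E]
    [InnerProductSpace ℝ E] [FiniteDimensional ℝ E] [MeasurableSpace E] [BorelSpace E]
    (V : Submodule ℝ E) {l : ℕ} (hl : Module.finrank ℝ Vᗮ = l) :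
    (stdGaussian E).map (fun g => (‖g - V.starProjection g‖ ^ 2, V.starProjection g)) =
      (chiSquared l).prod ((stdGaussian E).map V.starProjection) := by
  subst hl
  set u := stdOrthonormalBasis ℝ Vᗮ
  set v := stdOrthonormalBasis ℝ V
  -- Orthonormal bases of `Vᗮ` and `V` are glued to one of `E`. In it the coordinates are
  -- independent standard Gaussians, the residual sees only the left ones and the projection only
  -- the right ones.
  let w : Fin (Module.finrank ℝ Vᗮ) ⊕ Fin (Module.finrank ℝ V) → E :=
    Sum.elim (fun i => (u i : E)) (fun i => (v i : E))
  have hw : Orthonormal ℝ w := by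
    rw [orthonormal_iff_ite]
    have hu := orthonormal_iff_ite.1 u.orthonormal
    have hv := orthonormal_iff_ite.1 v.orthonormal
    rintro (i | i) (j | j)
    · simpa [w] using hu i j
    · simpa [w] using V.inner_left_of_mem_orthogonal (v j).2 (u i).2
    · simpa [w] using V.inner_right_of_mem_orthogonal (v i).2 (u j).2
    · simpa [w] using hv i j
  have hcard : Module.finrank ℝ E =
      Fintype.card (Fin (Module.finrank ℝ Vᗮ) ⊕ Fin (Module.finrank ℝ V)) := by
    simp [← V.finrank_add_finrank_orthogonal, add_comm]
  obtain ⟨b, hb⟩ := Orthonormal.exists_orthonormalBasis_extension_of_card_eq hcard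
    (v := w) (s := Set.univ) (hw.comp _ Subtype.val_injective)
  have hbl : ∀ i, b (Sum.inl i) = u i := fun i => hb _ (Set.mem_univ _)
  have hbr : ∀ i, b (Sum.inr i) = v i := fun i => hb _ (Set.mem_univ _)
  let G : (Fin (Module.finrank ℝ Vᗮ) ⊕ Fin (Module.finrank ℝ V) → ℝ) → E := fun x => ∑ i, x i • b i
  have hG : Measurable G := by fun_prop
  have hproj : ∀ x, V.starProjection (G x) = ∑ i, x (Sum.inr i) • (v i : E) := by
    intro x
    have h1 : V.starProjection (∑ i, x (Sum.inl i) • (u i : E)) = 0 := by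
      rw [V.starProjection_apply_eq_zero_iff]
      exact Submodule.sum_mem _ fun i _ => Submodule.smul_mem _ _ (u i).2
    have h2 : V.starProjection (∑ i, x (Sum.inr i) • (v i : E)) =
        ∑ i, x (Sum.inr i) • (v i : E) :=
      V.starProjection_eq_self_iff.2 (Submodule.sum_mem _ fun i _ => Submodule.smul_mem _ _ (v i).2)
    simp only [G, Fintype.sum_sum_type, hbl, hbr, map_add, h1, h2, zero_add]
  have hres : ∀ x, ‖G x - V.starProjection (G x)‖ ^ 2 = ∑ i, x (Sum.inl i) ^ 2 := by
    intro x
    have h1 : G x - V.starProjection (G x) = ((∑ i, x (Sum.inl i) • u i : Vᗮ) : E) := by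
      rw [hproj]
      simp [G, hbl, hbr]
    have h2 := EuclideanSpace.real_norm_sq_eq (u.repr (∑ i, x (Sum.inl i) • u i))
    rw [u.repr.norm_map] at h2
    rw [h1, ← Submodule.coe_norm, h2]
    refine Finset.sum_congr rfl fun i _ => ?_
    have h3 := u.sum_repr_symm (WithLp.toLp 2 fun i => x (Sum.inl i))
    simp only at h3
    rw [h3, u.repr.apply_symm_apply]
  let sL : (Fin (Module.finrank ℝ Vᗮ) → ℝ) → ℝ := fun x => ∑ i, x i ^ 2
  let sR : (Fin (Module.finrank ℝ V) → ℝ) → E := fun x => ∑ i, x i • (v i : E)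
  have hsL : Measurable sL := by fun_prop
  have hsR : Measurable sR := by fun_prop
  have hmp := measurePreserving_sumPiEquivProdPi
    (X := fun _ : Fin (Module.finrank ℝ Vᗮ) ⊕ Fin (Module.finrank ℝ V) => ℝ)
    (fun _ => gaussianReal 0 1)
  have hV : Measurable V.starProjection := by fun_prop
  have h1 : (stdGaussian E).map V.starProjection =
      (Measure.pi fun _ => gaussianReal 0 1).map sR := by
    rw [stdGaussian_eq_map_pi_orthonormalBasis b, Measure.map_map hV hG,
      ← (measurePreserving_snd.comp hmp).map_eq, Measure.map_map hsR (by fun_prop)]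
    exact congrArg (Measure.map · _) (funext hproj)
  have h2 : (stdGaussian E).map (fun g => (‖g - V.starProjection g‖ ^ 2, V.starProjection g)) =
      ((Measure.pi fun _ => gaussianReal 0 1).prod (Measure.pi fun _ => gaussianReal 0 1)).map
        (Prod.map sL sR) := by
    rw [stdGaussian_eq_map_pi_orthonormalBasis b, Measure.map_map (by fun_prop) hG,
      ← hmp.map_eq, Measure.map_map (by fun_prop) (by fun_prop)]
    exact congrArg (Measure.map · _) (funext fun x => Prod.ext (hres x) (hproj x))
  rw [h1, h2, ← Measure.map_prod_map _ _ hsL hsR]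
  rfl

/-- The law of `n` independent standard Gaussian vectors in `ℝ ^ p`. -/
def stdRows (n p : ℕ) : Measure (Fin n → EuclideanSpace ℝ (Fin p)) :=
  Measure.pi fun _ => stdGaussian (EuclideanSpace ℝ (Fin p))

instance (n p : ℕ) : IsProbabilityMeasure (stdRows n p) := by
  unfold stdRows; infer_instance

/-- The vector with first coordinate `t` and further coordinates `z`. -/
def consVec {k : ℕ} (t : ℝ) (z : EuclideanSpace ℝ (Fin k)) : EuclideanSpace ℝ (Fin (k + 1)) :=
  WithLp.toLp 2 (Fin.cons t z.ofLp : Fin (k + 1) → ℝ)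

@[simp] lemma consVec_zero {k : ℕ} (t : ℝ) (z : EuclideanSpace ℝ (Fin k)) : consVec t z 0 = t := rfl

@[simp] lemma consVec_succ {k : ℕ} (t : ℝ) (z : EuclideanSpace ℝ (Fin k)) (i : Fin k) :
    consVec t z i.succ = z i := rfl

lemma inner_consVec {k : ℕ} (t s : ℝ) (z a : EuclideanSpace ℝ (Fin k)) :
    inner ℝ (consVec t z) (consVec s a) = t * s + inner ℝ z a := by
  simp [PiLp.inner_apply, Fin.sum_univ_succ, mul_comm]

lemma norm_sq_consVec {k : ℕ} (t : ℝ) (z : EuclideanSpace ℝ (Fin k)) :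
    ‖consVec t z‖ ^ 2 = t ^ 2 + ‖z‖ ^ 2 := by
  simp [EuclideanSpace.real_norm_sq_eq, Fin.sum_univ_succ]

lemma consVec_eta {k : ℕ} (a : EuclideanSpace ℝ (Fin (k + 1))) :
    ∃ t z, a = consVec t z :=
  ⟨a 0, WithLp.toLp 2 fun i => a i.succ, by ext i; refine Fin.cases ?_ (fun i => ?_) i <;> simp⟩

lemma measurable_consVec {k : ℕ} :
    Measurable fun x : ℝ × EuclideanSpace ℝ (Fin k) => consVec x.1 x.2 := by
  refine (WithLp.measurable_toLp 2 _).comp (measurable_pi_lambda _ fun i => ?_)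
  refine Fin.cases ?_ (fun i => ?_) i
  · exact measurable_fst
  · simp only [Fin.cons_succ]; fun_prop

lemma measurePreserving_consVec (k : ℕ) :
    MeasurePreserving (fun x : ℝ × EuclideanSpace ℝ (Fin k) => consVec x.1 x.2)
      ((gaussianReal 0 1).prod (stdGaussian (EuclideanSpace ℝ (Fin k))))
      (stdGaussian (EuclideanSpace ℝ (Fin (k + 1)))) := by
  have h1 := ((MeasurePreserving.id (gaussianReal 0 1)).prod
    (⟨WithLp.measurable_toLp 2 _, map_pi_eq_stdGaussian⟩ : MeasurePreserving (WithLp.toLp 2)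
      (Measure.pi fun _ : Fin k => gaussianReal 0 1) (stdGaussian (EuclideanSpace ℝ (Fin k)))))
  have h2 := (measurePreserving_piFinSuccAbove (fun _ : Fin (k + 1) => gaussianReal 0 1) 0)
  have h3 : MeasurePreserving (WithLp.toLp 2)
      (Measure.pi fun _ : Fin (k + 1) => gaussianReal 0 1)
      (stdGaussian (EuclideanSpace ℝ (Fin (k + 1)))) :=
    ⟨WithLp.measurable_toLp 2 _, map_pi_eq_stdGaussian⟩
  refine ⟨measurable_consVec, ?_⟩
  rw [← (h1.comp h2).map_eq, Measure.map_map measurable_consVec (h1.comp h2).measurable,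
    ← h3.map_eq]
  congr 1
  ext x i
  refine Fin.cases ?_ (fun i => ?_) i
  · rfl
  · rfl

/-- The rows of the design matrix with first column `g` and further columns given by `z`. -/
def consRows {n k : ℕ} (g : EuclideanSpace ℝ (Fin n)) (z : Fin n → EuclideanSpace ℝ (Fin k)) :
    Fin n → EuclideanSpace ℝ (Fin (k + 1)) := fun i => consVec (g i) (z i)

/-- A matrix of independent Gaussian entries can be read by rows or by columns. Separating the first
column makes it possible to argue conditionally on the others. -/
lemma measurePreserving_consRows (n k : ℕ) :
    MeasurePreserving (fun x : EuclideanSpace ℝ (Fin n) × (Fin n → EuclideanSpace ℝ (Fin k)) =>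
      consRows x.1 x.2) ((stdGaussian (EuclideanSpace ℝ (Fin n))).prod (stdRows n k))
      (stdRows n (k + 1)) := by
  have h1 : MeasurePreserving (WithLp.toLp 2)
      (Measure.pi fun _ : Fin n => gaussianReal 0 1) (stdGaussian (EuclideanSpace ℝ (Fin n))) :=
    ⟨WithLp.measurable_toLp 2 _, map_pi_eq_stdGaussian⟩
  have h2 := h1.prod (MeasurePreserving.id (stdRows n k))
  have h3 := (measurePreserving_arrowProdEquivProdArrow ℝ (EuclideanSpace ℝ (Fin k)) (Fin n)
    (fun _ => gaussianReal 0 1) (fun _ => stdGaussian _))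
  have h4 := measurePreserving_pi _ _ (fun _ : Fin n => measurePreserving_consVec k)
  have hm : Measurable fun x : EuclideanSpace ℝ (Fin n) × (Fin n → EuclideanSpace ℝ (Fin k)) =>
      consRows x.1 x.2 := by
    refine measurable_pi_lambda _ fun i => ?_
    exact measurable_consVec.comp (f := fun x : EuclideanSpace ℝ (Fin n) ×
      (Fin n → EuclideanSpace ℝ (Fin k)) => (x.1 i, x.2 i)) (by fun_prop)
  refine ⟨hm, ?_⟩
  have h5 := h2.comp h3
  rw [← h5.map_eq, Measure.map_map hm h5.measurable]
  exact h4.map_eq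

end

/-! ### Deterministic algebra of Gram matrices and least squares. -/

section

variable {n p : ℕ}

/-- The Gram matrix `Xᵀ X` of the design matrix with rows `x i`. -/
def gram (x : Fin n → EuclideanSpace ℝ (Fin p)) : Matrix (Fin p) (Fin p) ℝ :=
  (Matrix.of fun i k => x i k)ᵀ * Matrix.of fun i k => x i k

/-- The product `(Xᵀ X)⁻¹ v`. -/
def gramSolve (x : Fin n → EuclideanSpace ℝ (Fin p)) (v : EuclideanSpace ℝ (Fin p)) :
    EuclideanSpace ℝ (Fin p) :=
  WithLp.toLp 2 ((gram x)⁻¹ *ᵥ v.ofLp)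

/-- The vectors `x i` span the space: only zero is orthogonal to all of them. -/
def Spanning (x : Fin n → EuclideanSpace ℝ (Fin p)) : Prop :=
  ∀ a, (∀ i, inner ℝ (x i) a = 0) → a = 0

lemma toLp_gram_mulVec (x : Fin n → EuclideanSpace ℝ (Fin p)) (a : EuclideanSpace ℝ (Fin p)) :
    WithLp.toLp 2 (gram x *ᵥ a.ofLp) = ∑ i, (inner ℝ (x i) a : ℝ) • x i := by
  ext k
  simp only [gram, ← Matrix.mulVec_mulVec]
  simp [Matrix.mulVec, dotProduct, PiLp.inner_apply, mul_comm]

lemma inner_sum_inner_smul (x : Fin n → EuclideanSpace ℝ (Fin p)) (a b : EuclideanSpace ℝ (Fin p)) :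
    inner ℝ (∑ i, (inner ℝ (x i) a : ℝ) • x i) b = ∑ i, inner ℝ (x i) a * inner ℝ (x i) b := by
  simp [sum_inner, real_inner_smul_left]

/-- The quadratic form of the Gram matrix at `a` is the sum of the `⟨x i, a⟩²`, so its kernel is the
set of vectors orthogonal to all `x i`. -/
lemma spanning_iff_det_ne_zero (x : Fin n → EuclideanSpace ℝ (Fin p)) :
    Spanning x ↔ (gram x).det ≠ 0 := by
  constructor
  · intro h hdet
    obtain ⟨v, hv, hv0⟩ := Matrix.exists_mulVec_eq_zero_iff.2 hdet
    have h1 := toLp_gram_mulVec x (WithLp.toLp 2 v)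
    rw [hv0] at h1
    have h2 := inner_sum_inner_smul x (WithLp.toLp 2 v) (WithLp.toLp 2 v)
    rw [← h1, WithLp.toLp_zero, inner_zero_left, eq_comm,
      Finset.sum_eq_zero_iff_of_nonneg fun i _ => mul_self_nonneg _] at h2
    have h3 := h (WithLp.toLp 2 v) fun i => mul_self_eq_zero.1 (h2 i (Finset.mem_univ i))
    exact hv (congrArg WithLp.ofLp h3)
  · intro h a ha
    have h1 := toLp_gram_mulVec x a
    simp only [ha, zero_smul, Finset.sum_const_zero] at h1
    have h2 := Matrix.eq_zero_of_mulVec_eq_zero h (congrArg WithLp.ofLp h1)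
    ext i
    exact congrFun h2 i

lemma sum_inner_gramSolve_smul {x : Fin n → EuclideanSpace ℝ (Fin p)} (hx : Spanning x)
    (v : EuclideanSpace ℝ (Fin p)) :
    ∑ i, (inner ℝ (x i) (gramSolve x v) : ℝ) • x i = v := by
  have hdet : IsUnit (gram x).det := ((spanning_iff_det_ne_zero x).1 hx).isUnit
  rw [← toLp_gram_mulVec, gramSolve, Matrix.mulVec_mulVec, Matrix.mul_nonsing_inv _ hdet,
    Matrix.one_mulVec]

/-- The explicit inverses below, such as the block inverse and the Sherman-Morrison formula, are all
verified through these normal equations. -/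
lemma eq_gramSolve {x : Fin n → EuclideanSpace ℝ (Fin p)} (hx : Spanning x)
    {a v : EuclideanSpace ℝ (Fin p)} (h : ∑ i, (inner ℝ (x i) a : ℝ) • x i = v) :
    gramSolve x v = a := by
  have hdet : IsUnit (gram x).det := ((spanning_iff_det_ne_zero x).1 hx).isUnit
  rw [← h, ← toLp_gram_mulVec, gramSolve, Matrix.mulVec_mulVec, Matrix.nonsing_inv_mul _ hdet,
    Matrix.one_mulVec]

lemma gramSolve_add (x : Fin n → EuclideanSpace ℝ (Fin p)) (u v : EuclideanSpace ℝ (Fin p)) :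
    gramSolve x (u + v) = gramSolve x u + gramSolve x v := by
  simp [gramSolve, Matrix.mulVec_add]

lemma gramSolve_smul (x : Fin n → EuclideanSpace ℝ (Fin p)) (c : ℝ) (v : EuclideanSpace ℝ (Fin p)) :
    gramSolve x (c • v) = c • gramSolve x v := by
  simp [gramSolve, Matrix.mulVec_smul]

lemma gramSolve_sum {ι : Type*} (s : Finset ι) (x : Fin n → EuclideanSpace ℝ (Fin p))
    (v : ι → EuclideanSpace ℝ (Fin p)) :
    gramSolve x (∑ i ∈ s, v i) = ∑ i ∈ s, gramSolve x (v i) := by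
  classical
  induction s using Finset.induction_on with
  | empty => simp [gramSolve]
  | insert a s ha ih => rw [Finset.sum_insert ha, Finset.sum_insert ha, gramSolve_add, ih]

/-- Spanning is not needed: transposition commutes with the inverse also for singular matrices,
whose inverse is zero by convention. -/
lemma inner_gramSolve_comm (x : Fin n → EuclideanSpace ℝ (Fin p)) (u v : EuclideanSpace ℝ (Fin p)) :
    (inner ℝ u (gramSolve x v) : ℝ) = inner ℝ (gramSolve x u) v := by
  have hsymm : ((gram x)⁻¹)ᵀ = (gram x)⁻¹ := by
    rw [Matrix.transpose_nonsing_inv, gram, Matrix.transpose_mul, Matrix.transpose_transpose]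
  have h1 : (inner ℝ u (gramSolve x v) : ℝ) = u.ofLp ⬝ᵥ ((gram x)⁻¹ *ᵥ v.ofLp) := by
    simp [gramSolve, PiLp.inner_apply, dotProduct, mul_comm]
  have h2 : (inner ℝ (gramSolve x u) v : ℝ) = ((gram x)⁻¹ *ᵥ u.ofLp) ⬝ᵥ v.ofLp := by
    simp [gramSolve, PiLp.inner_apply, dotProduct, mul_comm]
  rw [h1, h2, Matrix.dotProduct_mulVec, ← Matrix.mulVec_transpose, hsymm]

/-- The quadratic form of `(Xᵀ X)⁻¹` as a sum of squares. -/
lemma inner_gramSolve_eq_sum {x : Fin n → EuclideanSpace ℝ (Fin p)} (hx : Spanning x)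
    (u v : EuclideanSpace ℝ (Fin p)) :
    (inner ℝ u (gramSolve x v) : ℝ) =
      ∑ i, inner ℝ (x i) (gramSolve x u) * inner ℝ (x i) (gramSolve x v) := by
  rw [← inner_sum_inner_smul, sum_inner_gramSolve_smul hx]

lemma inner_gramSolve_self_nonneg {x : Fin n → EuclideanSpace ℝ (Fin p)} (hx : Spanning x)
    (v : EuclideanSpace ℝ (Fin p)) : 0 ≤ (inner ℝ v (gramSolve x v) : ℝ) := by
  rw [inner_gramSolve_eq_sum hx]
  exact Finset.sum_nonneg fun i _ => mul_self_nonneg _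

/-- A linear change of variables of the inputs preserves spanning. -/
lemma Spanning.comp_equiv {x : Fin n → EuclideanSpace ℝ (Fin p)} (hx : Spanning x)
    (L : EuclideanSpace ℝ (Fin p) ≃L[ℝ] EuclideanSpace ℝ (Fin p)) :
    Spanning fun i => L (x i) := by
  intro a ha
  have h1 : ContinuousLinearMap.adjoint (L : EuclideanSpace ℝ (Fin p) →L[ℝ] _) a = 0 := by
    refine hx _ fun i => ?_
    rw [ContinuousLinearMap.adjoint_inner_right]
    exact ha i
  have h2 : (inner ℝ (L (L.symm a)) a : ℝ) = 0 := by
    have := ContinuousLinearMap.adjoint_inner_right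
      (L : EuclideanSpace ℝ (Fin p) →L[ℝ] EuclideanSpace ℝ (Fin p)) (L.symm a) a
    rw [h1, inner_zero_right] at this
    exact this.symm
  rwa [L.apply_symm_apply, inner_self_eq_zero] at h2

/-- The change of variables replaces `A` by `L A Lᵀ`, and `Lᵀ (L A Lᵀ)⁻¹ L = A⁻¹`. -/
lemma adjoint_gramSolve_comp_equiv {x : Fin n → EuclideanSpace ℝ (Fin p)} (hx : Spanning x)
    (L : EuclideanSpace ℝ (Fin p) ≃L[ℝ] EuclideanSpace ℝ (Fin p)) (v : EuclideanSpace ℝ (Fin p)) :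
    ContinuousLinearMap.adjoint (L : EuclideanSpace ℝ (Fin p) →L[ℝ] _)
      (gramSolve (fun i => L (x i)) (L v)) = gramSolve x v := by
  symm
  apply eq_gramSolve hx
  apply L.injective
  have h := sum_inner_gramSolve_smul (hx.comp_equiv L) (L v)
  rw [map_sum]
  simp_rw [map_smul, ContinuousLinearMap.adjoint_inner_right]
  exact h

lemma inner_gramSolve_comp_equiv {x : Fin n → EuclideanSpace ℝ (Fin p)} (hx : Spanning x)
    (L : EuclideanSpace ℝ (Fin p) ≃L[ℝ] EuclideanSpace ℝ (Fin p)) (v : EuclideanSpace ℝ (Fin p)) :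
    (inner ℝ (L v) (gramSolve (fun i => L (x i)) (L v)) : ℝ) = inner ℝ v (gramSolve x v) := by
  rw [← adjoint_gramSolve_comp_equiv hx L, ContinuousLinearMap.adjoint_inner_right]
  rfl

/-! ### Measurability -/

lemma continuous_gram :
    Continuous (gram : (Fin n → EuclideanSpace ℝ (Fin p)) → Matrix (Fin p) (Fin p) ℝ) := by
  refine continuous_matrix fun k l => ?_
  simp only [gram, Matrix.mul_apply, Matrix.transpose_apply, Matrix.of_apply]
  fun_prop

lemma measurable_gramSolve :
    Measurable fun z : (Fin n → EuclideanSpace ℝ (Fin p)) × EuclideanSpace ℝ (Fin p) =>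
      gramSolve z.1 z.2 := by
  refine (WithLp.measurable_toLp 2 _).comp (measurable_pi_lambda _ fun k => ?_)
  simp only [Matrix.mulVec, dotProduct, Matrix.inv_def, Ring.inverse_eq_inv', Matrix.smul_apply,
    smul_eq_mul]
  refine Finset.measurable_sum _ fun l _ => Measurable.mul (Measurable.mul ?_ ?_) (by fun_prop)
  · exact (continuous_gram.matrix_det.measurable.inv).comp measurable_fst
  · exact (continuous_gram.matrix_adjugate.matrix_elem k l).measurable.comp measurable_fst

lemma measurable_gramSolve_comp {α : Type*} [MeasurableSpace α]
    {f : α → Fin n → EuclideanSpace ℝ (Fin p)} {g : α → EuclideanSpace ℝ (Fin p)}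
    (hf : Measurable f) (hg : Measurable g) : Measurable fun a => gramSolve (f a) (g a) := by
  have h : Measurable fun a => (f a, g a) := hf.prodMk hg
  have h' := Measurable.comp (measurable_gramSolve (n := n) (p := p)) h
  exact h'

lemma measurableSet_spanning :
    MeasurableSet {x : Fin n → EuclideanSpace ℝ (Fin p) | Spanning x} := by
  have h : {x : Fin n → EuclideanSpace ℝ (Fin p) | Spanning x} =
      (fun x => (gram x).det) ⁻¹' {0}ᶜ := by
    ext x
    exact spanning_iff_det_ne_zero x
  have hm : Measurable fun x : Fin n → EuclideanSpace ℝ (Fin p) => (gram x).det :=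
    continuous_gram.matrix_det.measurable
  rw [h]
  exact hm (measurableSet_singleton 0).compl

/-! ### Adding a column to the design matrix -/

/-- The linear map of the design matrix. -/
def designMap (z : Fin n → EuclideanSpace ℝ (Fin p)) :
    EuclideanSpace ℝ (Fin p) →ₗ[ℝ] EuclideanSpace ℝ (Fin n) where
  toFun a := WithLp.toLp 2 fun i => inner ℝ (z i) a
  map_add' a b := by ext i; simp [inner_add_right]
  map_smul' c a := by ext i; simp [real_inner_smul_right]

@[simp] lemma designMap_apply (z : Fin n → EuclideanSpace ℝ (Fin p)) (a : EuclideanSpace ℝ (Fin p))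
    (i : Fin n) : designMap z a i = inner ℝ (z i) a := rfl

/-- The coefficients of the least squares regression of `g` on the rows `z`. -/
def lsqCoef (z : Fin n → EuclideanSpace ℝ (Fin p)) (g : EuclideanSpace ℝ (Fin n)) :
    EuclideanSpace ℝ (Fin p) := gramSolve z (∑ i, g i • z i)

lemma inner_designMap (z : Fin n → EuclideanSpace ℝ (Fin p)) (a : EuclideanSpace ℝ (Fin p))
    (g : EuclideanSpace ℝ (Fin n)) : (inner ℝ g (designMap z a) : ℝ) = inner ℝ (∑ i, g i • z i) a := by
  simp [PiLp.inner_apply (𝕜 := ℝ) g, sum_inner, real_inner_smul_left, mul_comm]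

lemma finrank_range_designMap {z : Fin n → EuclideanSpace ℝ (Fin p)} (hz : Spanning z) :
    Module.finrank ℝ (LinearMap.range (designMap z)) = p := by
  rw [LinearMap.finrank_range_of_inj]
  · simp
  · rw [injective_iff_map_eq_zero]
    intro a ha
    exact hz a fun i => by rw [← designMap_apply, ha]; rfl

lemma sum_residual_smul {z : Fin n → EuclideanSpace ℝ (Fin p)} (hz : Spanning z)
    (g : EuclideanSpace ℝ (Fin n)) :
    ∑ i, (g - designMap z (lsqCoef z g)) i • z i = 0 := by
  have h : ∀ i, (g - designMap z (lsqCoef z g)) i • z i =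
      g i • z i - (inner ℝ (z i) (lsqCoef z g) : ℝ) • z i := fun i => by
    simp [sub_smul]
  simp_rw [h]
  rw [Finset.sum_sub_distrib, lsqCoef, sum_inner_gramSolve_smul hz, sub_self]

lemma starProjection_range_designMap {z : Fin n → EuclideanSpace ℝ (Fin p)} (hz : Spanning z)
    (g : EuclideanSpace ℝ (Fin n)) :
    (LinearMap.range (designMap z)).starProjection g = designMap z (lsqCoef z g) := by
  apply Submodule.eq_starProjection_of_mem_of_inner_eq_zero
  · exact ⟨_, rfl⟩
  · rintro _ ⟨a, rfl⟩
    rw [inner_designMap, sum_residual_smul hz, inner_zero_left]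

/-- As functions of the projection alone, the coefficients inherit its independence of the residual.
-/
lemma lsqCoef_starProjection {z : Fin n → EuclideanSpace ℝ (Fin p)} (hz : Spanning z)
    (g : EuclideanSpace ℝ (Fin n)) :
    lsqCoef z ((LinearMap.range (designMap z)).starProjection g) = lsqCoef z g := by
  rw [starProjection_range_designMap hz, lsqCoef, designMap]
  simp only [LinearMap.coe_mk, AddHom.coe_mk]
  rw [lsqCoef, sum_inner_gramSolve_smul hz]

lemma inner_residual_self {z : Fin n → EuclideanSpace ℝ (Fin p)} (hz : Spanning z)
    (g : EuclideanSpace ℝ (Fin n)) :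
    (inner ℝ (g - designMap z (lsqCoef z g)) g : ℝ) = ‖g - designMap z (lsqCoef z g)‖ ^ 2 := by
  have h := inner_designMap z (lsqCoef z g) (g - designMap z (lsqCoef z g))
  rw [sum_residual_smul hz, inner_zero_left] at h
  rw [← real_inner_self_eq_norm_sq, inner_sub_right (g - designMap z (lsqCoef z g)) g, h, sub_zero]

lemma spanning_consRows {z : Fin n → EuclideanSpace ℝ (Fin p)} (hz : Spanning z)
    {g : EuclideanSpace ℝ (Fin n)} (hg : g - designMap z (lsqCoef z g) ≠ 0) :
    Spanning (consRows g z) := by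
  intro a ha
  obtain ⟨s, a, rfl⟩ := consVec_eta a
  simp only [consRows, inner_consVec] at ha
  have h1 : s • g + designMap z a = 0 := by
    ext i
    simpa [mul_comm] using ha i
  -- Pairing with the residual `r` kills `designMap z a` and leaves `s ‖r‖² = 0`.
  have h2 := congrArg (inner ℝ (g - designMap z (lsqCoef z g)) : _ → ℝ) h1
  rw [inner_add_right, real_inner_smul_right, inner_residual_self hz, inner_designMap,
    sum_residual_smul hz, inner_zero_left, add_zero, inner_zero_right] at h2
  have hs : s = 0 := by
    rcases mul_eq_zero.1 h2 with h | h
    · exact h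
    · exact absurd (norm_eq_zero.1 (pow_eq_zero_iff two_ne_zero |>.1 h)) hg
  subst hs
  have h3 : a = 0 := hz a fun i => by simpa using ha i
  subst h3
  ext i
  refine Fin.cases ?_ (fun i => ?_) i <;> simp

/-- With `b` the regression coefficients, the enlarged design matrix sends `(1, -b)` to the residual
`r`. This is orthogonal to the old columns and has inner product `‖r‖²` with `g`, so `(1, -b) /
‖r‖²` solves the normal equations. -/
lemma gramSolve_consRows {z : Fin n → EuclideanSpace ℝ (Fin p)} (hz : Spanning z)
    {g : EuclideanSpace ℝ (Fin n)} (hg : g - designMap z (lsqCoef z g) ≠ 0) :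
    gramSolve (consRows g z) (consVec 1 0) =
      consVec (1 / ‖g - designMap z (lsqCoef z g)‖ ^ 2)
        (-(1 / ‖g - designMap z (lsqCoef z g)‖ ^ 2) • lsqCoef z g) := by
  have hr := inner_residual_self hz g
  have hs := sum_residual_smul hz g
  set r := g - designMap z (lsqCoef z g) with hrdef
  have hT : ‖r‖ ^ 2 ≠ 0 := by simpa using hg
  apply eq_gramSolve (spanning_consRows hz hg)
  have h1 : ∀ i, (inner ℝ (consRows g z i) (consVec (1 / ‖r‖ ^ 2)
      (-(1 / ‖r‖ ^ 2) • lsqCoef z g)) : ℝ) = (1 / ‖r‖ ^ 2) * r i := by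
    intro i
    rw [consRows, inner_consVec, real_inner_smul_right, hrdef]
    simp; ring
  simp_rw [h1, mul_smul]
  rw [← Finset.smul_sum]
  ext j
  refine Fin.cases ?_ (fun j => ?_) j
  · have h2 : (inner ℝ r g : ℝ) = ∑ i, r i * g i := by
      simp [PiLp.inner_apply, mul_comm]
    simp only [consRows, PiLp.smul_apply, WithLp.ofLp_sum, Finset.sum_apply, consVec_zero,
      smul_eq_mul, WithLp.ofLp_smul, Pi.smul_apply]
    rw [← h2, hr]
    field_simp
  · have h2 := congrFun (congrArg WithLp.ofLp hs) j
    simp only [consRows, PiLp.smul_apply, WithLp.ofLp_sum, Finset.sum_apply, consVec_succ,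
      smul_eq_mul, WithLp.ofLp_smul, Pi.smul_apply] at h2 ⊢
    rw [h2]
    simp

end

/-! ### Regression of a Gaussian column on fixed columns. -/

section

variable {n p : ℕ}

lemma measurable_lsqCoef (z : Fin n → EuclideanSpace ℝ (Fin p)) : Measurable (lsqCoef z) :=
  measurable_gramSolve_comp measurable_const (by fun_prop)

lemma measurable_designMap (z : Fin n → EuclideanSpace ℝ (Fin p)) : Measurable (designMap z) :=
  (LinearMap.continuous_of_finiteDimensional (designMap z)).measurable

lemma finrank_orthogonal_range_designMap {z : Fin n → EuclideanSpace ℝ (Fin p)} (hz : Spanning z) :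
    Module.finrank ℝ (LinearMap.range (designMap z))ᗮ = n - p := by
  have h := (LinearMap.range (designMap z)).finrank_add_finrank_orthogonal
  rw [finrank_range_designMap hz, finrank_euclideanSpace_fin] at h
  exact Nat.eq_sub_of_add_eq' h

/-- For a Gaussian response, the residual sum of squares is a chi-squared variable, independent of
the least squares coefficients. -/
lemma map_residual_lsqCoef {z : Fin n → EuclideanSpace ℝ (Fin p)} (hz : Spanning z) :
    (stdGaussian (EuclideanSpace ℝ (Fin n))).map
        (fun g => (‖g - designMap z (lsqCoef z g)‖ ^ 2, lsqCoef z g)) =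
      (chiSquared (n - p)).prod ((stdGaussian _).map (lsqCoef z)) := by
  have hm := measurable_lsqCoef z
  set V := LinearMap.range (designMap z)
  have hV : Measurable V.starProjection := by fun_prop
  have h := map_norm_sq_sub_starProjection_stdGaussian V (finrank_orthogonal_range_designMap hz)
  have h2 := congrArg (Measure.map (Prod.map id (lsqCoef z))) h
  rw [Measure.map_map (by fun_prop) (by fun_prop), ← Measure.map_prod_map _ _ measurable_id hm,
    Measure.map_id, Measure.map_map hm hV] at h2
  have h3 : lsqCoef z ∘ V.starProjection = lsqCoef z := funext fun g => lsqCoef_starProjection hz g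
  have h4 : Prod.map id (lsqCoef z) ∘ (fun g => (‖g - V.starProjection g‖ ^ 2, V.starProjection g)) =
      fun g => (‖g - designMap z (lsqCoef z g)‖ ^ 2, lsqCoef z g) := by
    funext g
    simp only [Function.comp_apply, Prod.map_apply, id_eq]
    rw [lsqCoef_starProjection hz, starProjection_range_designMap hz]
  rw [h3, h4] at h2
  exact h2

lemma map_residual {z : Fin n → EuclideanSpace ℝ (Fin p)} (hz : Spanning z) :
    (stdGaussian (EuclideanSpace ℝ (Fin n))).map (fun g => ‖g - designMap z (lsqCoef z g)‖ ^ 2) =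
      chiSquared (n - p) := by
  have hm := measurable_lsqCoef z
  have hd := measurable_designMap z
  have : IsProbabilityMeasure ((stdGaussian (EuclideanSpace ℝ (Fin n))).map (lsqCoef z)) :=
    Measure.isProbabilityMeasure_map hm.aemeasurable
  have h := congrArg (Measure.map Prod.fst) (map_residual_lsqCoef hz)
  rw [Measure.map_map measurable_fst (by fun_prop), Measure.map_fst_prod, measure_univ, one_smul] at h
  exact h

lemma residual_ne_zero_ae {z : Fin n → EuclideanSpace ℝ (Fin p)} (hz : Spanning z) (hp : p < n) :
    ∀ᵐ g ∂(stdGaussian (EuclideanSpace ℝ (Fin n))), g - designMap z (lsqCoef z g) ≠ 0 := by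
  have hm := measurable_lsqCoef z
  have hd := measurable_designMap z
  have h := chiSquared_pos_ae (k := n - p) (by lia)
  rw [← map_residual hz, ae_map_iff (Measurable.aemeasurable (by fun_prop)) measurableSet_Ioi] at h
  filter_upwards [h] with g hg h0
  simp [h0] at hg

/-- Independent standard Gaussian vectors almost surely span the space. -/
lemma spanning_ae_stdRows : ∀ {p : ℕ}, p ≤ n → ∀ᵐ z ∂(stdRows n p), Spanning z
  | 0, _ => .of_forall fun z a _ => by ext i; exact i.elim0
  | p + 1, hp => by
    have hmp := measurePreserving_consRows n p
    rw [← hmp.map_eq, ae_map_iff hmp.measurable.aemeasurable measurableSet_spanning]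
    -- Induction on the number of columns: given `p < n` spanning columns, an independent Gaussian
    -- column almost surely has a nonzero residual.
    have h : ∀ᵐ y ∂((stdRows n p).prod (stdGaussian (EuclideanSpace ℝ (Fin n)))),
        Spanning (consRows y.2 y.1) := by
      rw [Measure.ae_prod_iff_ae_ae]
      · filter_upwards [spanning_ae_stdRows (p := p) (by lia)] with z hz
        filter_upwards [residual_ne_zero_ae hz (by lia)] with g hg
        exact spanning_consRows hz hg
      · exact (hmp.measurable.comp measurable_swap) measurableSet_spanning
    rw [← Measure.prod_swap, ae_map_iff measurable_swap.aemeasurable] at h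
    · exact h
    · exact (hmp.measurable.comp measurable_swap) measurableSet_spanning

lemma integral_inner_sq_stdGaussian {E : Type*} [NormedAddCommGroup E] [InnerProductSpace ℝ E]
    [FiniteDimensional ℝ E] [MeasurableSpace E] [BorelSpace E] (u : E) :
    ∫ g, (inner ℝ u g : ℝ) ^ 2 ∂(stdGaussian E) = ‖u‖ ^ 2 := by
  have h := variance_dual_stdGaussian (innerSL ℝ u)
  rw [variance_of_integral_eq_zero (Measurable.aemeasurable (by fun_prop))
    (integral_strongDual_stdGaussian _), innerSL_apply_norm] at h
  exact h

lemma integrable_inner_sq_stdGaussian {E : Type*} [NormedAddCommGroup E] [InnerProductSpace ℝ E]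
    [FiniteDimensional ℝ E] [MeasurableSpace E] [BorelSpace E] (u : E) :
    Integrable (fun g => (inner ℝ u g : ℝ) ^ 2) (stdGaussian E) :=
  (IsGaussian.memLp_dual (stdGaussian E) (innerSL ℝ u) 2 (by simp)).integrable_sq

/-- The standard basis vectors. -/
abbrev stdVec (p : ℕ) (j : Fin p) : EuclideanSpace ℝ (Fin p) := EuclideanSpace.single j 1

/-- The `j`-th coefficient is the pairing of `g` with a fixed vector, the image under the design map
of the `j`-th column of `(Zᵀ Z)⁻¹`. Its variance is the squared norm of that vector, which is the
`j`-th diagonal entry of `(Zᵀ Z)⁻¹`. -/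
lemma lintegral_norm_sq_lsqCoef {z : Fin n → EuclideanSpace ℝ (Fin p)} (hz : Spanning z) :
    ∫⁻ g, ENNReal.ofReal (‖lsqCoef z g‖ ^ 2) ∂(stdGaussian (EuclideanSpace ℝ (Fin n))) =
      ∑ j, ENNReal.ofReal (inner ℝ (stdVec p j) (gramSolve z (stdVec p j))) := by
  have h1 : ∀ g, ENNReal.ofReal (‖lsqCoef z g‖ ^ 2) =
      ∑ j, ENNReal.ofReal ((inner ℝ (designMap z (gramSolve z (stdVec p j))) g : ℝ) ^ 2) := by
    intro g
    rw [EuclideanSpace.real_norm_sq_eq, ENNReal.ofReal_sum_of_nonneg fun _ _ => sq_nonneg _]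
    refine Finset.sum_congr rfl fun j _ => ?_
    rw [real_inner_comm, inner_designMap, inner_gramSolve_comm]
    simp [lsqCoef, EuclideanSpace.inner_single_right]
  simp_rw [h1]
  rw [lintegral_finsetSum _ fun j _ => by fun_prop]
  refine Finset.sum_congr rfl fun j _ => ?_
  rw [← ofReal_integral_eq_lintegral_ofReal (integrable_inner_sq_stdGaussian _)
    (.of_forall fun g => sq_nonneg _), integral_inner_sq_stdGaussian, inner_gramSolve_eq_sum hz,
    EuclideanSpace.real_norm_sq_eq]
  simp [sq]

end

/-! ### The first column of an inverse Wishart matrix, and reduction to the standard case. -/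

section

variable {n p : ℕ}

/-- The first standard basis vector. -/
abbrev firstVec (p : ℕ) : EuclideanSpace ℝ (Fin (p + 1)) := consVec 1 0

lemma inner_gramSolve_consRows {z : Fin n → EuclideanSpace ℝ (Fin p)} (hz : Spanning z)
    {g : EuclideanSpace ℝ (Fin n)} (hg : g - designMap z (lsqCoef z g) ≠ 0) :
    (inner ℝ (firstVec p) (gramSolve (consRows g z) (firstVec p)) : ℝ) =
      1 / ‖g - designMap z (lsqCoef z g)‖ ^ 2 := by
  rw [gramSolve_consRows hz hg, inner_consVec]
  simp

lemma norm_sq_gramSolve_consRows {z : Fin n → EuclideanSpace ℝ (Fin p)} (hz : Spanning z)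
    {g : EuclideanSpace ℝ (Fin n)} (hg : g - designMap z (lsqCoef z g) ≠ 0) :
    ‖gramSolve (consRows g z) (firstVec p)‖ ^ 2 =
      (1 / ‖g - designMap z (lsqCoef z g)‖ ^ 2) ^ 2 * (1 + ‖lsqCoef z g‖ ^ 2) := by
  rw [gramSolve_consRows hz hg, norm_sq_consVec, norm_smul, Real.norm_eq_abs, mul_pow, sq_abs]
  ring

lemma lintegral_stdRows_succ {f : (Fin n → EuclideanSpace ℝ (Fin (p + 1))) → ENNReal}
    (hf : Measurable f) :
    ∫⁻ z, f z ∂(stdRows n (p + 1)) =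
      ∫⁻ z, (∫⁻ g, f (consRows g z) ∂(stdGaussian (EuclideanSpace ℝ (Fin n)))) ∂(stdRows n p) := by
  have hmp := measurePreserving_consRows n p
  rw [← hmp.lintegral_comp hf, lintegral_prod_symm]
  exact (hf.comp hmp.measurable).aemeasurable

/-- Given the other columns, the first diagonal entry of the inverse is the reciprocal of the
residual sum of squares, whose law does not depend on them. The dimension is `p + 1`, so `n - p` is
the usual `n - dim + 1`. -/
lemma lintegral_inner_gramSolve_stdRows (hp : p < n) {F : ℝ → ENNReal} (hF : Measurable F) :
    ∫⁻ z, F (inner ℝ (firstVec p) (gramSolve z (firstVec p))) ∂(stdRows n (p + 1)) =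
      ∫⁻ t, F (1 / t) ∂(chiSquared (n - p)) := by
  have hgs : Measurable fun z : Fin n → EuclideanSpace ℝ (Fin (p + 1)) => gramSolve z (firstVec p) :=
    measurable_gramSolve_comp measurable_id measurable_const
  rw [lintegral_stdRows_succ (by fun_prop)]
  have h : ∀ᵐ z ∂(stdRows n p), (∫⁻ g, F (inner ℝ (firstVec p)
      (gramSolve (consRows g z) (firstVec p))) ∂(stdGaussian (EuclideanSpace ℝ (Fin n)))) =
      ∫⁻ t, F (1 / t) ∂(chiSquared (n - p)) := by
    filter_upwards [spanning_ae_stdRows hp.le] with z hz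
    have hm := measurable_lsqCoef z
    have hd := measurable_designMap z
    rw [← map_residual hz, lintegral_map (by fun_prop) (by fun_prop)]
    refine lintegral_congr_ae ?_
    filter_upwards [residual_ne_zero_ae hz hp] with g hg
    rw [inner_gramSolve_consRows hz hg]
  rw [lintegral_congr_ae h]
  simp

/-- Given the other columns, the integrand is `T⁻² F (1 / T)` times `1 + ‖b‖²`, and the integral
factors because `T` and `b` are independent. -/
lemma lintegral_norm_sq_gramSolve_consRows (hp : p < n) {F : ℝ → ENNReal} (hF : Measurable F)
    {z : Fin n → EuclideanSpace ℝ (Fin p)} (hz : Spanning z) :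
    (∫⁻ g, ENNReal.ofReal (‖gramSolve (consRows g z) (firstVec p)‖ ^ 2) *
      F (inner ℝ (firstVec p) (gramSolve (consRows g z) (firstVec p)))
        ∂(stdGaussian (EuclideanSpace ℝ (Fin n)))) =
      (∫⁻ t, ENNReal.ofReal ((1 / t) ^ 2) * F (1 / t) ∂(chiSquared (n - p))) *
        (1 + ∑ j, ENNReal.ofReal (inner ℝ (stdVec p j) (gramSolve z (stdVec p j)))) := by
  have hm := measurable_lsqCoef z
  have hd := measurable_designMap z
  have : IsProbabilityMeasure ((stdGaussian (EuclideanSpace ℝ (Fin n))).map (lsqCoef z)) :=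
    Measure.isProbabilityMeasure_map hm.aemeasurable
  have h1 : (∫⁻ b, ENNReal.ofReal (1 + ‖b‖ ^ 2)
      ∂((stdGaussian (EuclideanSpace ℝ (Fin n))).map (lsqCoef z))) =
      1 + ∑ j, ENNReal.ofReal (inner ℝ (stdVec p j) (gramSolve z (stdVec p j))) := by
    rw [← lintegral_norm_sq_lsqCoef hz, lintegral_map (by fun_prop) hm]
    simp_rw [ENNReal.ofReal_add zero_le_one (sq_nonneg _), ENNReal.ofReal_one]
    rw [lintegral_add_left measurable_const]
    simp
  rw [← h1, ← lintegral_prod_mul (Measurable.aemeasurable (by fun_prop))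
    (Measurable.aemeasurable (by fun_prop)), ← map_residual_lsqCoef hz,
    lintegral_map (by fun_prop) (by fun_prop)]
  refine lintegral_congr_ae ?_
  filter_upwards [residual_ne_zero_ae hz hp] with g hg
  rw [inner_gramSolve_consRows hz hg, norm_sq_gramSolve_consRows hz hg,
    ENNReal.ofReal_mul (by positivity)]
  ring

/-! ### Gaussian inputs with a general covariance matrix -/

/-- The law of `n` independent centred Gaussian vectors with covariance matrix `Sig`. -/
def gaussRows (n : ℕ) (Sig : Matrix (Fin p) (Fin p) ℝ) :
    Measure (Fin n → EuclideanSpace ℝ (Fin p)) :=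
  Measure.pi fun _ => multivariateGaussian 0 Sig

instance (n : ℕ) (Sig : Matrix (Fin p) (Fin p) ℝ) : IsProbabilityMeasure (gaussRows n Sig) := by
  unfold gaussRows; infer_instance

lemma gaussRows_one : gaussRows n (1 : Matrix (Fin p) (Fin p) ℝ) = stdRows n p := by
  simp [gaussRows, stdRows]

open scoped MatrixOrder in
/-- The symmetric square root of the covariance matrix. -/
def sqrtCov (Sig : Matrix (Fin p) (Fin p) ℝ) :
    EuclideanSpace ℝ (Fin p) →L[ℝ] EuclideanSpace ℝ (Fin p) :=
  Matrix.toEuclideanCLM (𝕜 := ℝ) (CFC.sqrt Sig)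

open scoped MatrixOrder in
lemma exists_equiv_sqrtCov {Sig : Matrix (Fin p) (Fin p) ℝ} (hSig : Sig.PosDef) :
    ∃ L : EuclideanSpace ℝ (Fin p) ≃L[ℝ] EuclideanSpace ℝ (Fin p),
      (L : EuclideanSpace ℝ (Fin p) →L[ℝ] EuclideanSpace ℝ (Fin p)) = sqrtCov Sig ∧
      ∀ x, ‖L.symm x‖ ^ 2 = mahalanobis Sig x := by
  set R := CFC.sqrt Sig with hR
  have hRR : R * R = Sig := CFC.sqrt_mul_sqrt_self _ hSig.posSemidef.nonneg
  have hdet : IsUnit R.det := by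
    have h := hSig.det_pos.ne'
    rw [← hRR, Matrix.det_mul] at h
    exact (left_ne_zero_of_mul h).isUnit
  have hsymm : Rᵀ = R := by
    have : IsSelfAdjoint R := (CFC.sqrt_nonneg Sig).isSelfAdjoint
    simpa [IsSelfAdjoint, Matrix.star_eq_conjTranspose] using this
  refine ⟨ContinuousLinearEquiv.equivOfInverse (Matrix.toEuclideanCLM (𝕜 := ℝ) R)
    (Matrix.toEuclideanCLM (𝕜 := ℝ) R⁻¹) (fun x => ?_) (fun x => ?_), ?_, fun x => ?_⟩
  · rw [← mul_apply_eq_comp, ← map_mul, Matrix.nonsing_inv_mul _ hdet, map_one]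
    rfl
  · rw [← mul_apply_eq_comp, ← map_mul, Matrix.mul_nonsing_inv _ hdet, map_one]
    rfl
  · rfl
  · change ‖Matrix.toEuclideanCLM (𝕜 := ℝ) R⁻¹ x‖ ^ 2 = _
    rw [EuclideanSpace.real_norm_sq_eq, mahalanobis, ← hRR, Matrix.mul_inv_rev,
      ← Matrix.mulVec_mulVec, Matrix.dotProduct_mulVec, ← Matrix.mulVec_transpose,
      Matrix.transpose_nonsing_inv, hsymm]
    simp [dotProduct, sq]

open scoped MatrixOrder in
lemma adjoint_sqrtCov (Sig : Matrix (Fin p) (Fin p) ℝ) :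
    ContinuousLinearMap.adjoint (sqrtCov Sig) = sqrtCov Sig :=
  IsSelfAdjoint.adjoint_eq ((CFC.sqrt_nonneg Sig).isSelfAdjoint.map _)

lemma mahalanobis_nonneg {Sig : Matrix (Fin p) (Fin p) ℝ} (hSig : Sig.PosDef)
    (x : EuclideanSpace ℝ (Fin p)) : 0 ≤ mahalanobis Sig x := by
  obtain ⟨L, -, hL⟩ := exists_equiv_sqrtCov hSig
  rw [← hL]; positivity

/-- A linear change of variables that maps the standard Gaussian law to a given one, and a multiple
of the first basis vector to a given vector. -/
lemma exists_equiv_map_stdGaussian {Sig : Matrix (Fin (p + 1)) (Fin (p + 1)) ℝ}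
    (hSig : Sig.PosDef) (x : EuclideanSpace ℝ (Fin (p + 1))) :
    ∃ L : EuclideanSpace ℝ (Fin (p + 1)) ≃L[ℝ] EuclideanSpace ℝ (Fin (p + 1)),
      (stdGaussian _).map L = multivariateGaussian 0 Sig ∧
      L (√(mahalanobis Sig x) • firstVec p) = x ∧
      ∀ a, ‖sqrtCov Sig a‖ = ‖ContinuousLinearMap.adjoint
        (L : EuclideanSpace ℝ (Fin (p + 1)) →L[ℝ] EuclideanSpace ℝ (Fin (p + 1))) a‖ := by
  obtain ⟨L, hL, hd⟩ := exists_equiv_sqrtCov hSig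
  have hnorm : ‖√(mahalanobis Sig x) • firstVec p‖ = ‖L.symm x‖ := by
    have h1 : ‖firstVec p‖ ^ 2 = 1 := by rw [norm_sq_consVec]; simp
    have h2 : ‖firstVec p‖ = 1 := (pow_eq_one_iff_of_nonneg (norm_nonneg _) two_ne_zero).1 h1
    rw [norm_smul, h2, mul_one, Real.norm_eq_abs, abs_of_nonneg (Real.sqrt_nonneg _), ← hd,
      Real.sqrt_sq (norm_nonneg _)]
  set v := √(mahalanobis Sig x) • firstVec p
  -- This reflection exchanges two vectors of equal norm and, as an isometry, preserves the standard
  -- Gaussian law.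
  set O := Submodule.reflection (ℝ ∙ (v - L.symm x))ᗮ with hO
  have hOv : O v = L.symm x := Submodule.reflection_sub hnorm
  refine ⟨O.toContinuousLinearEquiv.trans L, ?_, ?_, fun a => ?_⟩
  · have h1 : ⇑(O.toContinuousLinearEquiv.trans L) = ⇑L ∘ ⇑O := rfl
    have h2 : (⇑L : EuclideanSpace ℝ (Fin (p + 1)) → _) = fun x => 0 + sqrtCov Sig x := by
      funext y
      rw [zero_add, ← hL]
      rfl
    rw [h1, ← Measure.map_map (by fun_prop) (by fun_prop), stdGaussian_map, h2]
    rfl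
  · change L (O v) = x
    rw [hOv, L.apply_symm_apply]
  · have h1 : ((O.toContinuousLinearEquiv.trans L : EuclideanSpace ℝ (Fin (p + 1)) ≃L[ℝ] _) :
        EuclideanSpace ℝ (Fin (p + 1)) →L[ℝ] _) =
        (sqrtCov Sig) ∘L (O.toContinuousLinearEquiv : _ →L[ℝ] _) := by
      rw [← hL]; rfl
    rw [h1, ContinuousLinearMap.adjoint_comp, adjoint_sqrtCov, ContinuousLinearMap.comp_apply,
      LinearIsometryEquiv.adjoint_eq_symm]
    exact (O.symm.norm_map _).symm

end

/-! ### Moments of inverse Wishart matrices for a general covariance. -/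

section

variable {n p : ℕ}

lemma map_equiv_stdRows {Sig : Matrix (Fin p) (Fin p) ℝ}
    {L : EuclideanSpace ℝ (Fin p) ≃L[ℝ] EuclideanSpace ℝ (Fin p)}
    (hL : (stdGaussian _).map L = multivariateGaussian 0 Sig) :
    MeasurePreserving (fun (z : Fin n → EuclideanSpace ℝ (Fin p)) i => L (z i))
      (stdRows n p) (gaussRows n Sig) :=
  measurePreserving_pi _ _ fun _ => ⟨L.continuous.measurable, hL⟩

/-- Independent Gaussian inputs almost surely span the space. -/
lemma spanning_ae_gaussRows {Sig : Matrix (Fin p) (Fin p) ℝ} (hSig : Sig.PosDef) (hp : p ≤ n) :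
    ∀ᵐ x ∂(gaussRows n Sig), Spanning x := by
  rcases p with _ | p
  · exact .of_forall fun z a _ => by ext i; exact i.elim0
  obtain ⟨L, hL, -, -⟩ := exists_equiv_map_stdGaussian hSig 0
  have hmp := map_equiv_stdRows (n := n) hL
  rw [← hmp.map_eq, ae_map_iff hmp.measurable.aemeasurable measurableSet_spanning]
  filter_upwards [spanning_ae_stdRows hp] with z hz
  exact hz.comp_equiv L

lemma mahalanobis_fin_zero (Sig : Matrix (Fin 0) (Fin 0) ℝ) (x : EuclideanSpace ℝ (Fin 0)) :
    mahalanobis Sig x = 0 := by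
  simp [mahalanobis]

/-- The quadratic form is invariant under the change of variables that carries `√d e₁` to `x`, so it
is `d` times the first diagonal entry in the standard case. -/
lemma lintegral_inner_gramSolve_gaussRows {Sig : Matrix (Fin p) (Fin p) ℝ} (hSig : Sig.PosDef)
    (hp : p ≤ n) (x : EuclideanSpace ℝ (Fin p)) {F : ℝ → ENNReal} (hF : Measurable F) :
    ∫⁻ X, F (inner ℝ x (gramSolve X x)) ∂(gaussRows n Sig) =
      ∫⁻ t, F (mahalanobis Sig x / t) ∂(chiSquared (n - p + 1)) := by
  rcases p with _ | p
  · simp [mahalanobis_fin_zero, PiLp.inner_apply]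
  obtain ⟨L, hL, hx, -⟩ := exists_equiv_map_stdGaussian hSig x
  have hmp := map_equiv_stdRows (n := n) hL
  set d := mahalanobis Sig x with hd
  have hd0 : 0 ≤ d := mahalanobis_nonneg hSig x
  have hgs : Measurable fun X : Fin n → EuclideanSpace ℝ (Fin (p + 1)) => gramSolve X x :=
    measurable_gramSolve_comp measurable_id measurable_const
  rw [← hmp.lintegral_comp (by fun_prop)]
  have h : (∫⁻ z, F (inner ℝ x (gramSolve (fun i => L (z i)) x)) ∂(stdRows n (p + 1))) =
      ∫⁻ z, F (d * inner ℝ (firstVec p) (gramSolve z (firstVec p))) ∂(stdRows n (p + 1)) := by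
    refine lintegral_congr_ae ?_
    filter_upwards [spanning_ae_stdRows hp] with z hz
    conv_lhs => rw [← hx]
    rw [inner_gramSolve_comp_equiv hz, gramSolve_smul, real_inner_smul_left, real_inner_smul_right,
      ← mul_assoc, Real.mul_self_sqrt hd0]
  rw [h, lintegral_inner_gramSolve_stdRows (by lia) (F := fun s => F (d * s)) (by fun_prop),
    show n - (p + 1) + 1 = n - p by lia]
  simp [div_eq_mul_inv]

/-- The expectation of the trace of the inverse of a standard Wishart matrix. -/
lemma lintegral_trace_gramSolve_stdRows (hp : p + 2 ≤ n) :
    ∫⁻ z, (1 + ∑ j, ENNReal.ofReal (inner ℝ (stdVec p j) (gramSolve z (stdVec p j))))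
      ∂(stdRows n p) = ENNReal.ofReal ((n - 1) / (n - p - 1)) := by
  have hn : (p : ℝ) + 2 ≤ n := by exact_mod_cast hp
  have hgs : ∀ j, Measurable fun z : Fin n → EuclideanSpace ℝ (Fin p) =>
      gramSolve z (stdVec p j) :=
    fun j => measurable_gramSolve_comp measurable_id measurable_const
  -- Each diagonal entry is the inverse of a chi-squared variable with `n - p + 1` degrees of
  -- freedom, of mean `1 / (n - p - 1)`; adding `p` of these to `1` gives the claim.
  have h : ∀ j, ∫⁻ z, ENNReal.ofReal (inner ℝ (stdVec p j) (gramSolve z (stdVec p j)))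
      ∂(stdRows n p) = ENNReal.ofReal (1 / (n - p - 1)) := by
    intro j
    rw [← gaussRows_one, lintegral_inner_gramSolve_gaussRows (n := n) (Sig := 1) Matrix.PosDef.one
      (by lia) (stdVec p j) (F := ENNReal.ofReal) ENNReal.measurable_ofReal]
    have h1 : mahalanobis 1 (stdVec p j) = 1 := by
      simp [mahalanobis]
    rw [h1, lintegral_inv_chiSquared (by lia)]
    congr 2
    rw [Nat.cast_add, Nat.cast_sub (by lia)]
    push_cast; ring
  rw [lintegral_add_left measurable_const, lintegral_finsetSum _ fun j _ => by fun_prop]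
  simp_rw [h]
  have h0 : (0 : ℝ) < n - p - 1 := by linarith
  rw [lintegral_const, measure_univ, Finset.sum_const, Finset.card_univ, Fintype.card_fin,
    ← ENNReal.ofReal_nsmul, mul_one, ← ENNReal.ofReal_one, ← ENNReal.ofReal_add zero_le_one
    (by positivity)]
  congr 1
  rw [nsmul_eq_mul]
  field_simp
  ring

/-- The joint behaviour of `xᵀ A⁻¹ x` and `xᵀ A⁻¹ Σ A⁻¹ x` for a Wishart matrix `A = Xᵀ X`. -/
lemma lintegral_norm_sq_gramSolve_gaussRows {Sig : Matrix (Fin p) (Fin p) ℝ} (hSig : Sig.PosDef)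
    (hp : p + 2 ≤ n) (x : EuclideanSpace ℝ (Fin p)) {F : ℝ → ENNReal} (hF : Measurable F) :
    ∫⁻ X, ENNReal.ofReal (‖sqrtCov Sig (gramSolve X x)‖ ^ 2) * F (inner ℝ x (gramSolve X x))
      ∂(gaussRows n Sig) =
    ∫⁻ t, ENNReal.ofReal (((n - 1) / (n - p)) * (mahalanobis Sig x / t ^ 2)) *
      F (mahalanobis Sig x / t) ∂(chiSquared (n - p + 1)) := by
  rcases p with _ | p
  · have h : ∀ v : EuclideanSpace ℝ (Fin 0), v = 0 := fun v => by ext i; exact i.elim0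
    simp [mahalanobis_fin_zero, h (sqrtCov Sig _)]
  obtain ⟨L, hL, hx, hnorm⟩ := exists_equiv_map_stdGaussian hSig x
  have hmp := map_equiv_stdRows (n := n) hL
  set d := mahalanobis Sig x with hd
  have hd0 : 0 ≤ d := mahalanobis_nonneg hSig x
  have hn : (p : ℝ) + 1 + 2 ≤ n := by exact_mod_cast hp
  have hgs : ∀ x, Measurable fun X : Fin n → EuclideanSpace ℝ (Fin (p + 1)) => gramSolve X x :=
    fun x => measurable_gramSolve_comp measurable_id measurable_const
  have hgsx := hgs x
  have hgs1 := hgs (firstVec p)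
  rw [← hmp.lintegral_comp (by fun_prop)]
  have h : (∫⁻ z, ENNReal.ofReal (‖sqrtCov Sig (gramSolve (fun i => L (z i)) x)‖ ^ 2) *
        F (inner ℝ x (gramSolve (fun i => L (z i)) x)) ∂(stdRows n (p + 1))) =
      ∫⁻ z, ENNReal.ofReal (‖gramSolve z (firstVec p)‖ ^ 2) * (ENNReal.ofReal d *
        F (d * inner ℝ (firstVec p) (gramSolve z (firstVec p)))) ∂(stdRows n (p + 1)) := by
    refine lintegral_congr_ae ?_
    filter_upwards [spanning_ae_stdRows (by lia : p + 1 ≤ n)] with z hz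
    -- The adjoint of `L`, which has the same norms as `sqrtCov Sig`, is what undoes the change of
    -- variables in `gramSolve`.
    rw [hnorm]
    conv_lhs => rw [← hx]
    rw [inner_gramSolve_comp_equiv hz, adjoint_gramSolve_comp_equiv hz, gramSolve_smul,
      real_inner_smul_left, real_inner_smul_right,
      ← mul_assoc (√d), Real.mul_self_sqrt hd0, norm_smul, Real.norm_eq_abs, mul_pow, sq_abs,
      Real.sq_sqrt hd0, ENNReal.ofReal_mul hd0]
    ring
  rw [h, lintegral_stdRows_succ (by fun_prop)]
  have h2 : ∀ᵐ z ∂(stdRows n p), (∫⁻ g, ENNReal.ofReal (‖gramSolve (consRows g z) (firstVec p)‖ ^ 2)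
      * (ENNReal.ofReal d * F (d * inner ℝ (firstVec p) (gramSolve (consRows g z) (firstVec p))))
        ∂(stdGaussian (EuclideanSpace ℝ (Fin n)))) =
      (∫⁻ t, ENNReal.ofReal ((1 / t) ^ 2) * (ENNReal.ofReal d * F (d * (1 / t)))
        ∂(chiSquared (n - p))) *
        (1 + ∑ j, ENNReal.ofReal (inner ℝ (stdVec p j) (gramSolve z (stdVec p j)))) := by
    filter_upwards [spanning_ae_stdRows (by lia : p ≤ n)] with z hz
    exact lintegral_norm_sq_gramSolve_consRows (by lia)
      (F := fun s => ENNReal.ofReal d * F (d * s)) (by fun_prop) hz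
  have hgsj : ∀ j, Measurable fun z : Fin n → EuclideanSpace ℝ (Fin p) =>
      gramSolve z (stdVec p j) :=
    fun j => measurable_gramSolve_comp measurable_id measurable_const
  -- The trace is that of the Gram matrix of the remaining `p` of the `p + 1` columns, whence the
  -- factor `(n - 1) / (n - (p + 1))`.
  rw [lintegral_congr_ae h2, lintegral_const_mul _ (by fun_prop),
    lintegral_trace_gramSolve_stdRows (by lia), mul_comm, ← lintegral_const_mul _ (by fun_prop),
    show n - (p + 1) + 1 = n - p by lia]
  refine lintegral_congr fun t => ?_
  have h0 : (0 : ℝ) ≤ (n - 1) / (n - p - 1) := div_nonneg (by linarith) (by linarith)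
  rw [← mul_assoc (ENNReal.ofReal ((1 / t) ^ 2)), ← ENNReal.ofReal_mul (sq_nonneg _), ← mul_assoc,
    ← ENNReal.ofReal_mul h0, mul_one_div]
  congr 2
  push_cast
  rw [sub_sub (n : ℝ) p 1]
  ring

end

/-! ### The linear model and the risk of a linear predictor. -/

section

variable {n p : ℕ}

/-- The error of the linear predictor `xᵀ β`. -/
def noise (β : EuclideanSpace ℝ (Fin p)) (z : Point p) : ℝ := z.2 - inner ℝ z.1 β

lemma measurable_noise (β : EuclideanSpace ℝ (Fin p)) : Measurable (noise β) := by
  unfold noise; fun_prop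

/-- Laws of pairs `(X, Y)` with Gaussian inputs `X`, conditional mean `Xᵀ β` of `Y` and constant
conditional variance `σ²`. -/
structure IsLinearModel (P : Measure (Point p)) (β : EuclideanSpace ℝ (Fin p)) (σ : ℝ)
    (Sig : Matrix (Fin p) (Fin p) ℝ) : Prop where
  isProbabilityMeasure : IsProbabilityMeasure P
  map_fst : P.map Prod.fst = multivariateGaussian 0 Sig
  memLp_noise : MemLp (noise β) 2 P
  lintegral_mul_noise_sq : ∀ φ : EuclideanSpace ℝ (Fin p) → ENNReal, Measurable φ →
    ∫⁻ z, φ z.1 * ENNReal.ofReal (noise β z ^ 2) ∂P = ENNReal.ofReal (σ ^ 2) * ∫⁻ z, φ z.1 ∂P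
  integral_mul_noise : ∀ φ : EuclideanSpace ℝ (Fin p) → ℝ, Measurable φ →
    Integrable (fun z => φ z.1 * noise β z) P → ∫ z, φ z.1 * noise β z ∂P = 0

/-- The conditional expectation, tested on the sets `X ⁻¹' s`, shows that the image under `X` of the
measure with density `ε²` is `σ²` times the law of `X`. As an identity of measures this applies to
every nonnegative `φ`, integrable or not. -/
lemma lintegral_comp_mul_sq_of_condVar {Ω E : Type*} [MeasurableSpace Ω] [MeasurableSpace E]
    {μ : Measure Ω} [IsProbabilityMeasure μ] {X : Ω → E} (hX : Measurable X) {ε : Ω → ℝ}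
    (hε : MemLp ε 2 μ) {σ : ℝ}
    (h : μ[fun ω => ε ω ^ 2 | MeasurableSpace.comap X inferInstance] =ᵐ[μ] fun _ => σ ^ 2)
    {φ : E → ENNReal} (hφ : Measurable φ) :
    ∫⁻ ω, φ (X ω) * ENNReal.ofReal (ε ω ^ 2) ∂μ = ENNReal.ofReal (σ ^ 2) * ∫⁻ ω, φ (X ω) ∂μ := by
  have hm : MeasurableSpace.comap X inferInstance ≤ (inferInstance : MeasurableSpace Ω) :=
    hX.comap_le
  have hεm : AEMeasurable (fun ω => ENNReal.ofReal (ε ω ^ 2)) μ :=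
    (hε.aestronglyMeasurable.aemeasurable.pow_const 2).ennreal_ofReal
  have hν : (μ.withDensity fun ω => ENNReal.ofReal (ε ω ^ 2)).map X =
      ENNReal.ofReal (σ ^ 2) • μ.map X := by
    ext s hs
    rw [Measure.map_apply hX hs, withDensity_apply _ (hX hs), Measure.smul_apply,
      Measure.map_apply hX hs, smul_eq_mul,
      ← ofReal_integral_eq_lintegral_ofReal hε.integrable_sq.integrableOn
        (.of_forall fun ω => sq_nonneg _),
      ← setIntegral_condExp hm hε.integrable_sq ⟨s, hs, rfl⟩,
      setIntegral_congr_ae (g := fun _ => σ ^ 2) (hX hs) (h.mono fun ω hω _ => hω)]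
    rw [setIntegral_const, smul_eq_mul, mul_comm, ENNReal.ofReal_mul (sq_nonneg _),
      Measure.real, ENNReal.ofReal_toReal (measure_ne_top _ _)]
  have h1 := congrArg (fun ν => ∫⁻ x, φ x ∂ν) hν
  simp only [lintegral_smul_measure, lintegral_map hφ hX] at h1
  rw [lintegral_withDensity_eq_lintegral_mul₀ hεm
    (g := fun ω => φ (X ω)) (hφ.comp hX).aemeasurable] at h1
  simpa [mul_comm] using h1

lemma isLinearModel_map {Ω : Type*} [MeasurableSpace Ω] {μ : Measure Ω} [IsProbabilityMeasure μ]
    {X : Ω → EuclideanSpace ℝ (Fin p)} {Y : Ω → ℝ} (hX : Measurable X) (hY : MemLp Y 2 μ)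
    {β : EuclideanSpace ℝ (Fin p)} {σ : ℝ} {Sig : Matrix (Fin p) (Fin p) ℝ}
    (hXlaw : μ.map X = multivariateGaussian 0 Sig)
    (hmean : μ[Y | MeasurableSpace.comap X inferInstance] =ᵐ[μ] fun ω => inner ℝ (X ω) β)
    (hvar : condVar (MeasurableSpace.comap X inferInstance) Y μ =ᵐ[μ] fun _ => σ ^ 2) :
    IsLinearModel (μ.map fun ω => (X ω, Y ω)) β σ Sig := by
  have hm : MeasurableSpace.comap X inferInstance ≤ (inferInstance : MeasurableSpace Ω) :=
    hX.comap_le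
  have hXY : AEMeasurable (fun ω => (X ω, Y ω)) μ :=
    hX.aemeasurable.prodMk hY.aestronglyMeasurable.aemeasurable
  set ε : Ω → ℝ := fun ω => Y ω - inner ℝ (X ω) β with hεdef
  have hεae : ε =ᵐ[μ] Y - μ[Y | MeasurableSpace.comap X inferInstance] := by
    filter_upwards [hmean] with ω hω
    simp [hεdef, hω]
  have hε : MemLp ε 2 μ := (memLp_congr_ae hεae).2 (hY.sub (hY.condExp one_le_two))
  have hεsq : μ[fun ω => ε ω ^ 2 | MeasurableSpace.comap X inferInstance] =ᵐ[μ]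
      fun _ => σ ^ 2 := by
    refine (condExp_congr_ae ?_).trans hvar
    filter_upwards [hεae] with ω hω
    simp [hω]
  have hε0 : μ[ε | MeasurableSpace.comap X inferInstance] =ᵐ[μ] 0 := by
    have h1 := condExp_sub (μ := μ) (m := MeasurableSpace.comap X inferInstance)
      (hY.integrable one_le_two) (integrable_condExp
        (f := Y) (μ := μ) (m := MeasurableSpace.comap X inferInstance))
    have h2 := condExp_of_stronglyMeasurable hm (stronglyMeasurable_condExp
      (f := Y) (μ := μ) (m := MeasurableSpace.comap X inferInstance)) integrable_condExp
    rw [h2, sub_self] at h1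
    exact (condExp_congr_ae hεae).trans h1
  refine ⟨Measure.isProbabilityMeasure_map hXY, ?_, ?_, fun φ hφ => ?_, fun φ hφ hint => ?_⟩
  · rw [AEMeasurable.map_map_of_aemeasurable measurable_fst.aemeasurable hXY, ← hXlaw]
    rfl
  · exact (memLp_map_measure_iff (measurable_noise β).aestronglyMeasurable hXY).2 hε
  · have hmeas := measurable_noise β
    rw [lintegral_map' (by fun_prop) hXY, lintegral_map' (by fun_prop) hXY]
    exact lintegral_comp_mul_sq_of_condVar hX hε hεsq hφ
  · have hmeas := measurable_noise β
    rw [integrable_map_measure (Measurable.aestronglyMeasurable (by fun_prop)) hXY] at hint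
    rw [integral_map hXY (Measurable.aestronglyMeasurable (by fun_prop))]
    have hφX : StronglyMeasurable[MeasurableSpace.comap X inferInstance] fun ω => φ (X ω) :=
      (hφ.comp (comap_measurable X)).stronglyMeasurable
    have h1 := condExp_mul_of_stronglyMeasurable_left (μ := μ) (g := ε) hφX hint
      (hε.integrable one_le_two)
    calc ∫ ω, φ (X ω) * ε ω ∂μ
        = ∫ ω, (μ[(fun ω => φ (X ω)) * ε | MeasurableSpace.comap X inferInstance]) ω ∂μ :=
          (integral_condExp hm).symm
      _ = ∫ ω, 0 ∂μ := by
          refine integral_congr_ae ?_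
          filter_upwards [h1, hε0] with ω h1 h2
          simp [h1, h2]
      _ = 0 := by simp

lemma integral_inner_sq_multivariateGaussian (Sig : Matrix (Fin p) (Fin p) ℝ)
    (v : EuclideanSpace ℝ (Fin p)) :
    ∫ x, (inner ℝ x v : ℝ) ^ 2 ∂(multivariateGaussian 0 Sig) = ‖sqrtCov Sig v‖ ^ 2 := by
  rw [multivariateGaussian, integral_map (by fun_prop) (by fun_prop),
    ← integral_inner_sq_stdGaussian]
  refine integral_congr_ae (.of_forall fun g => ?_)
  simp only [zero_add]
  change (inner ℝ (sqrtCov Sig g) v : ℝ) ^ 2 = _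
  rw [← ContinuousLinearMap.adjoint_inner_right, adjoint_sqrtCov, real_inner_comm]

namespace IsLinearModel

variable {P : Measure (Point p)} {β : EuclideanSpace ℝ (Fin p)} {σ : ℝ}
  {Sig : Matrix (Fin p) (Fin p) ℝ}

lemma memLp_inner (h : IsLinearModel P β σ Sig) (v : EuclideanSpace ℝ (Fin p)) :
    MemLp (fun z : Point p => (inner ℝ z.1 v : ℝ)) 2 P := by
  have h1 : MemLp (fun x : EuclideanSpace ℝ (Fin p) => (inner ℝ x v : ℝ)) 2 (P.map Prod.fst) := by
    rw [h.map_fst]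
    have h2 := IsGaussian.memLp_dual (multivariateGaussian 0 Sig) (innerSL ℝ v) 2 (by simp)
    refine h2.congr_norm (by fun_prop) (.of_forall fun x => ?_)
    simp [real_inner_comm]
  exact h1.comp_measurePreserving ⟨measurable_fst, rfl⟩

lemma integral_noise_sq (h : IsLinearModel P β σ Sig) : ∫ z, noise β z ^ 2 ∂P = σ ^ 2 := by
  have := h.isProbabilityMeasure
  have h1 := h.lintegral_mul_noise_sq (fun _ => 1) measurable_const
  simp only [one_mul, lintegral_one, measure_univ, mul_one] at h1
  rw [integral_eq_lintegral_of_nonneg_ae (.of_forall fun z => sq_nonneg _)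
    h.memLp_noise.integrable_sq.aestronglyMeasurable, h1, ENNReal.toReal_ofReal (sq_nonneg _)]

/-- The prediction risk of a linear predictor. -/
lemma integral_sub_inner_sq (h : IsLinearModel P β σ Sig) (b : EuclideanSpace ℝ (Fin p)) :
    ∫ z : Point p, (z.2 - inner ℝ z.1 b) ^ 2 ∂P = σ ^ 2 + ‖sqrtCov Sig (b - β)‖ ^ 2 := by
  have h1 := h.memLp_noise.integrable_sq
  have h2 := (h.memLp_inner (b - β)).integrable_sq
  have h3 : Integrable (fun z : Point p => (inner ℝ z.1 (b - β) : ℝ) * noise β z) P :=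
    (h.memLp_inner (b - β)).integrable_mul h.memLp_noise
  have h4 := h.integral_mul_noise (fun x => inner ℝ x (b - β)) (by fun_prop) h3
  have h5 : ∫ z : Point p, (inner ℝ z.1 (b - β) : ℝ) ^ 2 ∂P = ‖sqrtCov Sig (b - β)‖ ^ 2 := by
    rw [← integral_inner_sq_multivariateGaussian, ← h.map_fst,
      integral_map (by fun_prop) (by fun_prop)]
  have h6 : ∀ z : Point p, (z.2 - inner ℝ z.1 b) ^ 2 =
      noise β z ^ 2 - 2 * (inner ℝ z.1 (b - β) * noise β z) + (inner ℝ z.1 (b - β) : ℝ) ^ 2 := by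
    intro z
    rw [noise, inner_sub_right]
    ring
  simp_rw [h6]
  have h7 : Integrable (fun z => noise β z ^ 2 - 2 * (inner ℝ z.1 (b - β) * noise β z)) P :=
    h1.sub (h3.const_mul 2)
  rw [integral_add h7 h2, integral_sub h1 (h3.const_mul 2),
    integral_const_mul, h4, h5, h.integral_noise_sq]
  ring

end IsLinearModel

end

/-! ### Second moments of linear combinations of the errors. -/

section

variable {n p : ℕ}

lemma integrable_inner_of_memLp_two {α E : Type*} [MeasurableSpace α] {μ : Measure α}
    [NormedAddCommGroup E] [InnerProductSpace ℝ E] {f g : α → E} (hf : MemLp f 2 μ)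
    (hg : MemLp g 2 μ) : Integrable (fun a => (inner ℝ (f a) (g a) : ℝ)) μ :=
  (hf.norm.integrable_mul hg.norm).mono'
    (hf.aestronglyMeasurable.inner hg.aestronglyMeasurable)
    (.of_forall fun a => norm_inner_le_norm (f a) (g a))

/-- The inputs of a data set. -/
def inputs (S : Fin n → Point p) : Fin n → EuclideanSpace ℝ (Fin p) := fun i => (S i).1

lemma measurable_inputs : Measurable (inputs : (Fin n → Point p) → _) := by
  unfold inputs; fun_prop

namespace IsLinearModel

variable {P : Measure (Point p)} {β : EuclideanSpace ℝ (Fin p)} {σ : ℝ}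
  {Sig : Matrix (Fin p) (Fin p) ℝ}

lemma measurePreserving_inputs (h : IsLinearModel P β σ Sig) :
    MeasurePreserving (inputs (n := n)) (Measure.pi fun _ => P) (gaussRows n Sig) := by
  have := h.isProbabilityMeasure
  exact measurePreserving_pi _ _ fun _ => ⟨measurable_fst, h.map_fst⟩

/-- By Tonelli the other observations can be frozen, which leaves the identity for one observation.
-/
lemma lintegral_inputs_mul_noise_sq (h : IsLinearModel P β σ Sig) (i : Fin n)
    {φ : (Fin n → EuclideanSpace ℝ (Fin p)) → ENNReal} (hφ : Measurable φ) :
    ∫⁻ S, φ (inputs S) * ENNReal.ofReal (noise β (S i) ^ 2) ∂(Measure.pi fun _ => P) =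
      ENNReal.ofReal (σ ^ 2) * ∫⁻ x, φ x ∂(gaussRows n Sig) := by
  have := h.isProbabilityMeasure
  have hmeas := measurable_noise β
  have hin := measurable_inputs (n := n) (p := p)
  rw [← h.measurePreserving_inputs.lintegral_comp hφ]
  rcases n with _ | n
  · exact i.elim0
  have hmp := (measurePreserving_piFinSuccAbove (fun _ : Fin (n + 1) => P) i).symm
  have hmm := hmp.measurable
  rw [← hmp.lintegral_comp (by fun_prop), ← hmp.lintegral_comp (by fun_prop),
    lintegral_prod_symm' _ (by fun_prop), lintegral_prod_symm' _ (by fun_prop),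
    ← lintegral_const_mul' _ _ ENNReal.ofReal_ne_top]
  refine lintegral_congr fun S => ?_
  have h1 : ∀ z : Point p, inputs ((MeasurableEquiv.piFinSuccAbove (fun _ => Point p) i).symm (z, S)) =
      i.insertNth z.1 (inputs S) := by
    intro z
    funext k
    refine Fin.succAboveCases i ?_ (fun k => ?_) k <;>
      simp [inputs, MeasurableEquiv.piFinSuccAbove, Fin.insertNthEquiv]
  have h2 : ∀ z : Point p,
      (MeasurableEquiv.piFinSuccAbove (fun _ => Point p) i).symm (z, S) i = z := by
    intro z
    simp [MeasurableEquiv.piFinSuccAbove, Fin.insertNthEquiv]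
  simp only [h1, h2]
  refine h.lintegral_mul_noise_sq (fun x => φ (i.insertNth x (inputs S))) (hφ.comp ?_)
  refine measurable_pi_lambda _ fun k => ?_
  refine Fin.succAboveCases i ?_ (fun k => ?_) k
  · simp only [Fin.insertNth_apply_same]
    exact measurable_id
  · simp

/-- The error of one observation is uncorrelated with functions of the other observations and of
all inputs. -/
lemma integral_mul_noise_eq_zero (h : IsLinearModel P β σ Sig) (i : Fin n)
    {φ : (Fin n → Point p) → ℝ} (hφ : Measurable φ)
    (hi : ∀ S, φ (Function.update S i ((S i).1, 0)) = φ S)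
    (hint : Integrable (fun S => φ S * noise β (S i)) (Measure.pi fun _ => P)) :
    ∫ S, φ S * noise β (S i) ∂(Measure.pi fun _ => P) = 0 := by
  have := h.isProbabilityMeasure
  rcases n with _ | n
  · exact i.elim0
  have hmp := (measurePreserving_piFinSuccAbove (fun _ : Fin (n + 1) => P) i).symm
  have hmm := hmp.measurable
  have h2 : ∀ (z : Point p) S,
      (MeasurableEquiv.piFinSuccAbove (fun _ => Point p) i).symm (z, S) i = z := by
    intro z S
    simp [MeasurableEquiv.piFinSuccAbove, Fin.insertNthEquiv]
  -- By `hi` the `i`-th output can be replaced by `0`, so with the other observations frozen `φ` is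
  -- a function of the `i`-th input.
  have h3 : ∀ (z : Point p) S, φ ((MeasurableEquiv.piFinSuccAbove (fun _ => Point p) i).symm (z, S)) =
      φ ((MeasurableEquiv.piFinSuccAbove (fun _ => Point p) i).symm ((z.1, 0), S)) := by
    intro z S
    rw [← hi, h2]
    congr 1
    simp [MeasurableEquiv.piFinSuccAbove, Fin.insertNthEquiv]
  have hint' := (hmp.integrable_comp_emb (MeasurableEquiv.measurableEmbedding _)).2 hint
  rw [← hmp.integral_comp']
  refine (integral_prod_symm _ hint').trans (integral_eq_zero_of_ae ?_)
  filter_upwards [hint'.prod_left_ae] with S hS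
  simp only [Function.comp_apply, h2] at hS ⊢
  simp_rw [h3 _ S] at hS ⊢
  exact h.integral_mul_noise (fun x => φ ((MeasurableEquiv.piFinSuccAbove (fun _ => Point p) i).symm
    ((x, 0), S))) (by fun_prop) hS

lemma memLp_noise_smul (h : IsLinearModel P β σ Sig) (i : Fin n)
    {w : (Fin n → EuclideanSpace ℝ (Fin p)) → EuclideanSpace ℝ (Fin p)} (hw : Measurable w)
    (hint : MemLp w 2 (gaussRows n Sig)) :
    MemLp (fun S => noise β (S i) • w (inputs S)) 2 (Measure.pi fun _ => P) ∧
      ∫ S, ‖noise β (S i) • w (inputs S)‖ ^ 2 ∂(Measure.pi fun _ => P) =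
        σ ^ 2 * ∫ x, ‖w x‖ ^ 2 ∂(gaussRows n Sig) := by
  have := h.isProbabilityMeasure
  have hmeas := measurable_noise β
  have hin := measurable_inputs (n := n) (p := p)
  have hf : Measurable fun S : Fin n → Point p => noise β (S i) • w (inputs S) := by fun_prop
  have h0 : ∫⁻ S, ENNReal.ofReal (‖noise β (S i) • w (inputs S)‖ ^ 2) ∂(Measure.pi fun _ => P) =
      ENNReal.ofReal (σ ^ 2 * ∫ x, ‖w x‖ ^ 2 ∂(gaussRows n Sig)) := by
    rw [ENNReal.ofReal_mul (sq_nonneg _), ofReal_integral_eq_lintegral_ofReal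
      hint.integrable_norm_pow' (.of_forall fun x => by positivity),
      ← h.lintegral_inputs_mul_noise_sq i (by fun_prop)]
    refine lintegral_congr fun S => ?_
    rw [norm_smul, mul_pow, Real.norm_eq_abs, sq_abs, mul_comm, ENNReal.ofReal_mul (sq_nonneg _)]
  constructor
  · rw [memLp_two_iff_integrable_sq_norm hf.aestronglyMeasurable]
    refine ⟨Measurable.aestronglyMeasurable (by fun_prop), ?_⟩
    rw [hasFiniteIntegral_iff_ofReal (.of_forall fun S => sq_nonneg _), h0]
    exact ENNReal.ofReal_lt_top
  · rw [integral_eq_lintegral_of_nonneg_ae (.of_forall fun S => sq_nonneg _)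
      (Measurable.aestronglyMeasurable (by fun_prop)), h0, ENNReal.toReal_ofReal]
    exact mul_nonneg (sq_nonneg _) (integral_nonneg fun x => sq_nonneg _)

/-- The second moment of a linear combination of the errors, with coefficients that depend on the
inputs only. -/
lemma integral_norm_sq_sum_noise_smul (h : IsLinearModel P β σ Sig)
    {w : Fin n → (Fin n → EuclideanSpace ℝ (Fin p)) → EuclideanSpace ℝ (Fin p)}
    (hw : ∀ i, Measurable (w i)) (hw2 : ∀ i, MemLp (w i) 2 (gaussRows n Sig))
    {v : (Fin n → EuclideanSpace ℝ (Fin p)) → EuclideanSpace ℝ (Fin p)} (hv : Measurable v)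
    (hv2 : MemLp v 2 (gaussRows n Sig)) :
    Integrable (fun S => ‖∑ i, noise β (S i) • w i (inputs S) + v (inputs S)‖ ^ 2)
      (Measure.pi fun _ => P) ∧
    ∫ S, ‖∑ i, noise β (S i) • w i (inputs S) + v (inputs S)‖ ^ 2 ∂(Measure.pi fun _ => P) =
      ∫ x, (σ ^ 2 * ∑ i, ‖w i x‖ ^ 2 + ‖v x‖ ^ 2) ∂(gaussRows n Sig) := by
  have := h.isProbabilityMeasure
  have hmeas := measurable_noise β
  have hin := measurable_inputs (n := n) (p := p)
  set f : Fin n → (Fin n → Point p) → EuclideanSpace ℝ (Fin p) :=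
    fun i S => noise β (S i) • w i (inputs S) with hf
  have hf2 : ∀ i, MemLp (f i) 2 (Measure.pi fun _ => P) :=
    fun i => (h.memLp_noise_smul i (hw i) (hw2 i)).1
  have hg2 : MemLp (fun S => v (inputs S)) 2 (Measure.pi fun _ : Fin n => P) :=
    hv2.comp_measurePreserving h.measurePreserving_inputs
  have hsum : MemLp (fun S => ∑ i, f i S + v (inputs S)) 2 (Measure.pi fun _ : Fin n => P) :=
    (memLp_finsetSum _ fun i _ => hf2 i).add hg2
  refine ⟨hsum.integrable_norm_pow', ?_⟩
  have hexp : ∀ S, ‖∑ i, f i S + v (inputs S)‖ ^ 2 =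
      ∑ i, ∑ k, inner ℝ (f i S) (f k S) + 2 * ∑ i, inner ℝ (f i S) (v (inputs S)) +
        ‖v (inputs S)‖ ^ 2 := by
    intro S
    rw [norm_add_sq_real, ← real_inner_self_eq_norm_sq (∑ i, f i S), sum_inner, sum_inner]
    simp_rw [inner_sum]
  have hff : ∀ i k, Integrable (fun S => (inner ℝ (f i S) (f k S) : ℝ)) (Measure.pi fun _ => P) :=
    fun i k => integrable_inner_of_memLp_two (hf2 i) (hf2 k)
  have hfg : ∀ i, Integrable (fun S => (inner ℝ (f i S) (v (inputs S)) : ℝ))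
      (Measure.pi fun _ => P) :=
    fun i => integrable_inner_of_memLp_two (hf2 i) hg2
  -- The `i`-th error enters linearly, against a factor made of the inputs and of the `k`-th error;
  -- such products have mean zero.
  have hff0 : ∀ i k, i ≠ k → ∫ S, (inner ℝ (f i S) (f k S) : ℝ) ∂(Measure.pi fun _ => P) = 0 := by
    intro i k hik
    have he : ∀ S, (inner ℝ (f i S) (f k S) : ℝ) =
        (noise β (S k) * inner ℝ (w i (inputs S)) (w k (inputs S))) * noise β (S i) := by
      intro S
      simp only [hf, real_inner_smul_left, real_inner_smul_right]
      ring
    have hi := hff i k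
    simp_rw [he] at hi ⊢
    refine h.integral_mul_noise_eq_zero i (by fun_prop) (fun S => ?_) hi
    have h1 : inputs (Function.update S i ((S i).1, 0)) = inputs S := by
      funext j
      by_cases hj : j = i
      · subst hj; simp [inputs]
      · simp [inputs, hj]
    rw [h1, Function.update_of_ne hik.symm]
  have hfg0 : ∀ i, ∫ S, (inner ℝ (f i S) (v (inputs S)) : ℝ) ∂(Measure.pi fun _ => P) = 0 := by
    intro i
    have he : ∀ S, (inner ℝ (f i S) (v (inputs S)) : ℝ) =
        inner ℝ (w i (inputs S)) (v (inputs S)) * noise β (S i) := by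
      intro S
      simp only [hf, real_inner_smul_left]
      ring
    have hi := hfg i
    simp_rw [he] at hi ⊢
    refine h.integral_mul_noise_eq_zero i (by fun_prop) (fun S => ?_) hi
    have h1 : inputs (Function.update S i ((S i).1, 0)) = inputs S := by
      funext j
      by_cases hj : j = i
      · subst hj; simp [inputs]
      · simp [inputs, hj]
    rw [h1]
  have hdiag : ∀ i, ∫ S, (inner ℝ (f i S) (f i S) : ℝ) ∂(Measure.pi fun _ => P) =
      σ ^ 2 * ∫ x, ‖w i x‖ ^ 2 ∂(gaussRows n Sig) := by
    intro i
    simp_rw [real_inner_self_eq_norm_sq]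
    exact (h.memLp_noise_smul i (hw i) (hw2 i)).2
  have hvv : ∫ S, ‖v (inputs S)‖ ^ 2 ∂(Measure.pi fun _ : Fin n => P) =
      ∫ x, ‖v x‖ ^ 2 ∂(gaussRows n Sig) := by
    rw [← h.measurePreserving_inputs.map_eq, integral_map hin.aemeasurable
      (Measurable.aestronglyMeasurable (by fun_prop))]
  change ∫ S, ‖∑ i, f i S + v (inputs S)‖ ^ 2 ∂(Measure.pi fun _ => P) = _
  simp_rw [hexp]
  have i1 : Integrable (fun S => ∑ i, ∑ k, (inner ℝ (f i S) (f k S) : ℝ))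
      (Measure.pi fun _ : Fin n => P) :=
    integrable_finsetSum _ fun i _ => integrable_finsetSum _ fun k _ => hff i k
  have i2 : Integrable (fun S => 2 * ∑ i, (inner ℝ (f i S) (v (inputs S)) : ℝ))
      (Measure.pi fun _ : Fin n => P) :=
    (integrable_finsetSum _ fun i _ => hfg i).const_mul 2
  have i12 : Integrable (fun S => ∑ i, ∑ k, (inner ℝ (f i S) (f k S) : ℝ) +
      2 * ∑ i, (inner ℝ (f i S) (v (inputs S)) : ℝ)) (Measure.pi fun _ : Fin n => P) := i1.add i2
  have iw : ∀ i, Integrable (fun x => ‖w i x‖ ^ 2) (gaussRows n Sig) :=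
    fun i => (hw2 i).integrable_norm_pow'
  rw [integral_add i12 hg2.integrable_norm_pow', integral_add i1 i2, integral_const_mul,
    integral_finsetSum _ fun i _ => hfg i,
    integral_finsetSum _ fun i _ => integrable_finsetSum _ fun k _ => hff i k,
    integral_add ((integrable_finsetSum _ fun i _ => iw i).const_mul _) hv2.integrable_norm_pow',
    integral_const_mul, integral_finsetSum _ fun i _ => iw i, hvv]
  have hin' : ∀ i, ∫ S, (∑ k, (inner ℝ (f i S) (f k S) : ℝ)) ∂(Measure.pi fun _ => P) =
      ∑ k, ∫ S, (inner ℝ (f i S) (f k S) : ℝ) ∂(Measure.pi fun _ => P) :=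
    fun i => integral_finsetSum _ fun k _ => hff i k
  simp_rw [hin', hfg0]
  congr 1
  rw [Finset.sum_const_zero, mul_zero, add_zero, Finset.mul_sum]
  refine Finset.sum_congr rfl fun i _ => ?_
  rw [Finset.sum_eq_single i (fun k _ hk => hff0 i k hk.symm) (by simp), hdiag]

end IsLinearModel

end

/-! ### The effect of a new observation on the least squares error. -/

section

variable {n p : ℕ}

/-! ### The least squares estimator -/

lemma ridgeEstimator_zero (S : Fin n → Point p) :
    ridgeEstimator 0 S = gramSolve (inputs S) (∑ i, (S i).2 • (S i).1) := by
  have h1 : (designMatrix S)ᵀ * designMatrix S + (0 : ℝ) • (1 : Matrix (Fin p) (Fin p) ℝ) =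
      gram (inputs S) := by
    rw [zero_smul, add_zero]
    rfl
  have h2 : (designMatrix S)ᵀ *ᵥ outputVector S = (∑ i, (S i).2 • (S i).1).ofLp := by
    ext k
    simp [designMatrix, outputVector, Matrix.mulVec, dotProduct, mul_comm]
  rw [ridgeEstimator, h1, h2]
  rfl

/-- The error of the least squares estimator is a linear combination of the errors of the data. -/
lemma ridgeEstimator_zero_sub {S : Fin n → Point p} (hS : Spanning (inputs S))
    (β : EuclideanSpace ℝ (Fin p)) :
    ridgeEstimator 0 S - β = ∑ i, noise β (S i) • gramSolve (inputs S) (S i).1 := by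
  have h1 : gramSolve (inputs S) (∑ i, (inner ℝ (inputs S i) β : ℝ) • inputs S i) = β :=
    eq_gramSolve hS rfl
  conv_lhs => rw [← h1]
  rw [ridgeEstimator_zero, gramSolve_sum, gramSolve_sum, ← Finset.sum_sub_distrib]
  refine Finset.sum_congr rfl fun i _ => ?_
  rw [gramSolve_smul, gramSolve_smul, noise, sub_smul]
  rfl

lemma inputs_snoc (S : Fin n → Point p) (z : Point p) :
    inputs (Fin.snoc S z : Fin (n + 1) → Point p) =
      (Fin.snoc (inputs S) z.1 : Fin (n + 1) → EuclideanSpace ℝ (Fin p)) := by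
  funext i
  refine Fin.lastCases ?_ (fun i => ?_) i <;> simp [inputs]

lemma Spanning.snoc {X : Fin n → EuclideanSpace ℝ (Fin p)} (hX : Spanning X)
    (x : EuclideanSpace ℝ (Fin p)) :
    Spanning (Fin.snoc X x : Fin (n + 1) → EuclideanSpace ℝ (Fin p)) := by
  intro a ha
  refine hX a fun i => ?_
  simpa using ha i.castSucc

/-- The Sherman-Morrison formula. -/
lemma gramSolve_snoc {X : Fin n → EuclideanSpace ℝ (Fin p)} (hX : Spanning X)
    (x u : EuclideanSpace ℝ (Fin p)) :
    gramSolve (Fin.snoc X x : Fin (n + 1) → EuclideanSpace ℝ (Fin p)) u =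
      gramSolve X u - ((inner ℝ x (gramSolve X u) : ℝ) / (1 + inner ℝ x (gramSolve X x))) •
        gramSolve X x := by
  have h0 := inner_gramSolve_self_nonneg hX x
  apply eq_gramSolve (hX.snoc x)
  rw [Fin.sum_univ_castSucc]
  simp only [Fin.snoc_castSucc, Fin.snoc_last, inner_sub_right, real_inner_smul_right, sub_smul,
    mul_smul]
  rw [Finset.sum_sub_distrib, ← Finset.smul_sum, sum_inner_gramSolve_smul hX,
    sum_inner_gramSolve_smul hX, sub_add, smul_smul, ← sub_smul, ← sub_smul]
  have h1 : (inner ℝ x (gramSolve X u) : ℝ) / (1 + inner ℝ x (gramSolve X x)) -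
      (inner ℝ x (gramSolve X u) - inner ℝ x (gramSolve X u) / (1 + inner ℝ x (gramSolve X x)) *
        inner ℝ x (gramSolve X x)) = 0 := by
    field_simp
    ring
  rw [h1, zero_smul, sub_zero]

lemma gramSolve_snoc_last {X : Fin n → EuclideanSpace ℝ (Fin p)} (hX : Spanning X)
    (x : EuclideanSpace ℝ (Fin p)) :
    gramSolve (Fin.snoc X x : Fin (n + 1) → EuclideanSpace ℝ (Fin p)) x =
      (1 / (1 + (inner ℝ x (gramSolve X x) : ℝ))) • gramSolve X x := by
  have h0 := inner_gramSolve_self_nonneg hX x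
  rw [gramSolve_snoc hX]
  nth_rewrite 1 [← one_smul ℝ (gramSolve X x)]
  rw [← sub_smul]
  congr 1
  field_simp
  ring

/-! ### The weights of the errors -/

/-- The weight of the error of the `i`-th observation, before an observation with input `x` is
added. -/
def weight (Sig : Matrix (Fin p) (Fin p) ℝ) (i : Fin n) (X : Fin n → EuclideanSpace ℝ (Fin p)) :
    EuclideanSpace ℝ (Fin p) := sqrtCov Sig (gramSolve X (X i))

/-- The leverage `xᵀ (Xᵀ X)⁻¹ x`. -/
def leverage (x : EuclideanSpace ℝ (Fin p)) (X : Fin n → EuclideanSpace ℝ (Fin p)) : ℝ :=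
  inner ℝ x (gramSolve X x)

/-- The vector `Σ^(1/2) (Xᵀ X)⁻¹ x`. -/
def influence (Sig : Matrix (Fin p) (Fin p) ℝ) (x : EuclideanSpace ℝ (Fin p))
    (X : Fin n → EuclideanSpace ℝ (Fin p)) : EuclideanSpace ℝ (Fin p) :=
  sqrtCov Sig (gramSolve X x)

/-- The weight of the error of the `i`-th observation, after an observation with input `x` is
added. -/
def weightInsert (Sig : Matrix (Fin p) (Fin p) ℝ) (x : EuclideanSpace ℝ (Fin p)) (i : Fin n)
    (X : Fin n → EuclideanSpace ℝ (Fin p)) : EuclideanSpace ℝ (Fin p) :=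
  weight Sig i X - ((inner ℝ x (gramSolve X (X i)) : ℝ) / (1 + leverage x X)) • influence Sig x X

lemma measurable_gramSolve_const (x : EuclideanSpace ℝ (Fin p)) :
    Measurable fun X : Fin n → EuclideanSpace ℝ (Fin p) => gramSolve X x :=
  measurable_gramSolve_comp measurable_id measurable_const

lemma measurable_leverage (x : EuclideanSpace ℝ (Fin p)) :
    Measurable (leverage x : (Fin n → EuclideanSpace ℝ (Fin p)) → ℝ) := by
  have := measurable_gramSolve_const (n := n) x
  unfold leverage; fun_prop

lemma measurable_influence (Sig : Matrix (Fin p) (Fin p) ℝ) (x : EuclideanSpace ℝ (Fin p)) :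
    Measurable (influence Sig x : (Fin n → EuclideanSpace ℝ (Fin p)) → _) := by
  have := measurable_gramSolve_const (n := n) x
  unfold influence; fun_prop

lemma measurable_gramSolve_eval (i : Fin n) :
    Measurable fun X : Fin n → EuclideanSpace ℝ (Fin p) => gramSolve X (X i) :=
  measurable_gramSolve_comp measurable_id (measurable_pi_apply i)

lemma measurable_weight (Sig : Matrix (Fin p) (Fin p) ℝ) (i : Fin n) :
    Measurable (weight Sig i) := by
  have := measurable_gramSolve_eval (p := p) i
  unfold weight; fun_prop

lemma measurable_weightInsert (Sig : Matrix (Fin p) (Fin p) ℝ) (x : EuclideanSpace ℝ (Fin p))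
    (i : Fin n) : Measurable (weightInsert Sig x i) := by
  have h1 := measurable_gramSolve_eval (p := p) i
  have h2 := measurable_weight Sig i
  have h3 := measurable_leverage (n := n) x
  have h4 := measurable_influence (n := n) Sig x
  unfold weightInsert; fun_prop

/-- Both sides are the trace of `Σ^(1/2) A⁻¹ Σ^(1/2)`. On the right, integrability follows from that
of leverages. -/
lemma sum_norm_sq_weight {X : Fin n → EuclideanSpace ℝ (Fin p)} (hX : Spanning X)
    (Sig : Matrix (Fin p) (Fin p) ℝ) :
    ∑ i, ‖weight Sig i X‖ ^ 2 = ∑ k, leverage (sqrtCov Sig (stdVec p k)) X := by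
  have h1 : ∀ i, ‖weight Sig i X‖ ^ 2 =
      ∑ k, (inner ℝ (X i) (gramSolve X (sqrtCov Sig (stdVec p k))) : ℝ) *
        inner ℝ (X i) (gramSolve X (sqrtCov Sig (stdVec p k))) := by
    intro i
    rw [EuclideanSpace.real_norm_sq_eq]
    refine Finset.sum_congr rfl fun k _ => ?_
    have h2 : weight Sig i X k = inner ℝ (stdVec p k) (weight Sig i X) := by
      simp [EuclideanSpace.inner_single_left]
    rw [h2, weight, ← ContinuousLinearMap.adjoint_inner_left, adjoint_sqrtCov,
      inner_gramSolve_comm, real_inner_comm, sq]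
  rw [Finset.sum_congr rfl fun i _ => h1 i, Finset.sum_comm]
  refine Finset.sum_congr rfl fun k _ => ?_
  rw [leverage, inner_gramSolve_eq_sum hX]

/-- With `a i = xᵀ A⁻¹ x i`, the normal equations give `∑ a i • weight i = influence` and `∑ (a i)²
= leverage`. Expanding the squares, with `l` the leverage, leaves the coefficient `-2 / (1 + l) + l
/ (1 + l)² = -(2 + l) / (1 + l)²`. -/
lemma sum_norm_sq_weightInsert {X : Fin n → EuclideanSpace ℝ (Fin p)} (hX : Spanning X)
    (Sig : Matrix (Fin p) (Fin p) ℝ) (x : EuclideanSpace ℝ (Fin p)) :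
    ∑ i, ‖weightInsert Sig x i X‖ ^ 2 = ∑ i, ‖weight Sig i X‖ ^ 2 -
      ‖influence Sig x X‖ ^ 2 * ((2 + leverage x X) / (1 + leverage x X) ^ 2) := by
  have h0 : 0 ≤ leverage x X := inner_gramSolve_self_nonneg hX x
  set a : Fin n → ℝ := fun i => inner ℝ x (gramSolve X (X i)) with ha
  have ha' : ∀ i, a i = inner ℝ (X i) (gramSolve X x) := fun i => by
    rw [ha]
    simp only
    rw [inner_gramSolve_comm, real_inner_comm]
  have h1 : ∑ i, a i • weight Sig i X = influence Sig x X := by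
    have h2 : ∀ i, a i • weight Sig i X = sqrtCov Sig (gramSolve X (a i • X i)) := fun i => by
      rw [gramSolve_smul, map_smul, weight]
    simp_rw [h2]
    rw [← map_sum, ← gramSolve_sum]
    simp_rw [ha']
    rw [sum_inner_gramSolve_smul hX, influence]
  have h3 : ∑ i, a i ^ 2 = leverage x X := by
    rw [leverage, inner_gramSolve_eq_sum hX]
    exact Finset.sum_congr rfl fun i _ => by rw [ha', sq]
  have h4 : ∀ i, ‖weightInsert Sig x i X‖ ^ 2 = ‖weight Sig i X‖ ^ 2 -
      2 / (1 + leverage x X) * inner ℝ (a i • weight Sig i X) (influence Sig x X) +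
      a i ^ 2 * (‖influence Sig x X‖ ^ 2 / (1 + leverage x X) ^ 2) := by
    intro i
    change ‖weight Sig i X - (a i / (1 + leverage x X)) • influence Sig x X‖ ^ 2 = _
    rw [norm_sub_sq_real, norm_smul, mul_pow, Real.norm_eq_abs, sq_abs,
      real_inner_smul_left, real_inner_smul_right]
    field_simp
  simp_rw [h4]
  rw [Finset.sum_add_distrib, Finset.sum_sub_distrib, ← Finset.mul_sum, ← sum_inner, h1,
    real_inner_self_eq_norm_sq, ← Finset.sum_mul, h3]
  field_simp
  ring

/-! ### Integrability of the weights -/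

section

variable {Sig : Matrix (Fin p) (Fin p) ℝ}

lemma integrable_leverage (hSig : Sig.PosDef) (hp : p + 2 ≤ n) (x : EuclideanSpace ℝ (Fin p)) :
    Integrable (leverage x) (gaussRows n Sig) := by
  have hm := measurable_leverage (n := n) x
  refine ⟨hm.aestronglyMeasurable, ?_⟩
  rw [hasFiniteIntegral_iff_ofReal]
  · have h := lintegral_inner_gramSolve_gaussRows hSig (by lia : p ≤ n) x
      ENNReal.measurable_ofReal
    have hi := (integrable_inv_chiSquared (k := n - p + 1) (by lia)).const_mul (mahalanobis Sig x)
    unfold leverage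
    rw [h]
    simp_rw [mul_one_div] at hi
    exact hi.lintegral_lt_top
  · filter_upwards [spanning_ae_gaussRows hSig (by lia : p ≤ n)] with X hX
    exact inner_gramSolve_self_nonneg hX x

lemma integrable_sum_norm_sq_weight (hSig : Sig.PosDef) (hp : p + 2 ≤ n) :
    Integrable (fun X => ∑ i, ‖weight Sig i X‖ ^ 2) (gaussRows n Sig) := by
  have h : Integrable (fun X => ∑ k, leverage (sqrtCov Sig (stdVec p k)) X) (gaussRows n Sig) :=
    integrable_finsetSum _ fun k _ => integrable_leverage hSig hp _
  refine h.congr ?_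
  filter_upwards [spanning_ae_gaussRows hSig (by lia : p ≤ n)] with X hX
  rw [sum_norm_sq_weight hX]

lemma memLp_two_of_norm_sq_le {α E : Type*} [MeasurableSpace α] {μ : Measure α}
    [NormedAddCommGroup E] {f : α → E} (hf : AEStronglyMeasurable f μ) {g : α → ℝ}
    (hg : Integrable g μ) (h : ∀ᵐ a ∂μ, ‖f a‖ ^ 2 ≤ g a) : MemLp f 2 μ := by
  rw [memLp_two_iff_integrable_sq_norm hf]
  refine hg.mono' (hf.norm.pow 2) ?_
  filter_upwards [h] with a ha
  rwa [Real.norm_eq_abs, abs_of_nonneg (sq_nonneg _)]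

lemma memLp_weight (hSig : Sig.PosDef) (hp : p + 2 ≤ n) (i : Fin n) :
    MemLp (weight Sig i) 2 (gaussRows n Sig) :=
  memLp_two_of_norm_sq_le (measurable_weight Sig i).aestronglyMeasurable
    (integrable_sum_norm_sq_weight hSig hp) (.of_forall fun X =>
      Finset.single_le_sum (f := fun i => ‖weight Sig i X‖ ^ 2) (fun _ _ => sq_nonneg _)
        (Finset.mem_univ i))

lemma memLp_weightInsert (hSig : Sig.PosDef) (hp : p + 2 ≤ n) (x : EuclideanSpace ℝ (Fin p))
    (i : Fin n) : MemLp (weightInsert Sig x i) 2 (gaussRows n Sig) := by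
  refine memLp_two_of_norm_sq_le (measurable_weightInsert Sig x i).aestronglyMeasurable
    (integrable_sum_norm_sq_weight hSig hp) ?_
  filter_upwards [spanning_ae_gaussRows hSig (by lia : p ≤ n)] with X hX
  have h0 : 0 ≤ leverage x X := inner_gramSolve_self_nonneg hX x
  have h1 : 0 ≤ ‖influence Sig x X‖ ^ 2 * ((2 + leverage x X) / (1 + leverage x X) ^ 2) := by
    positivity
  have h2 := Finset.single_le_sum (f := fun i => ‖weightInsert Sig x i X‖ ^ 2)
    (fun _ _ => sq_nonneg _) (Finset.mem_univ i)
  simp only [sum_norm_sq_weightInsert hX] at h2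
  linarith

/-- The function is dominated by the sum of the squared weights, since their difference is itself a
sum of squares. -/
lemma integrable_norm_sq_influence_mul (hSig : Sig.PosDef) (hp : p + 2 ≤ n)
    (x : EuclideanSpace ℝ (Fin p)) :
    Integrable (fun X => ‖influence Sig x X‖ ^ 2 *
      ((2 + leverage x X) / (1 + leverage x X) ^ 2)) (gaussRows n Sig) := by
  have hm1 := measurable_leverage (n := n) x
  have hm2 := measurable_influence (n := n) Sig x
  refine (integrable_sum_norm_sq_weight hSig hp).mono'
    (Measurable.aestronglyMeasurable (by fun_prop)) ?_
  filter_upwards [spanning_ae_gaussRows hSig (by lia : p ≤ n)] with X hX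
  have h0 : 0 ≤ leverage x X := inner_gramSolve_self_nonneg hX x
  rw [Real.norm_eq_abs, abs_of_nonneg (by positivity)]
  have h1 := sum_norm_sq_weightInsert hX Sig x
  have h2 : 0 ≤ ∑ i, ‖weightInsert Sig x i X‖ ^ 2 := Finset.sum_nonneg fun _ _ => sq_nonneg _
  linarith

lemma integrable_norm_sq_influence_div (hSig : Sig.PosDef) (hp : p + 2 ≤ n)
    (x : EuclideanSpace ℝ (Fin p)) :
    Integrable (fun X => ‖influence Sig x X‖ ^ 2 * (1 / (1 + leverage x X) ^ 2))
      (gaussRows n Sig) := by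
  have hm1 := measurable_leverage (n := n) x
  have hm2 := measurable_influence (n := n) Sig x
  refine (integrable_norm_sq_influence_mul hSig hp x).mono'
    (Measurable.aestronglyMeasurable (by fun_prop)) ?_
  filter_upwards [spanning_ae_gaussRows hSig (by lia : p ≤ n)] with X hX
  have h0 : 0 ≤ leverage x X := inner_gramSolve_self_nonneg hX x
  rw [Real.norm_eq_abs, abs_of_nonneg (by positivity)]
  gcongr
  linarith

/-- Integrals of functions of the leverage and of the influence, as integrals for a chi-squared
law. -/
lemma integral_norm_sq_influence_mul (hSig : Sig.PosDef) (hp : p + 2 ≤ n)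
    (x : EuclideanSpace ℝ (Fin p)) {F : ℝ → ℝ} (hF : Measurable F) (hF0 : ∀ s, 0 ≤ s → 0 ≤ F s)
    (hint : Integrable (fun X => ‖influence Sig x X‖ ^ 2 * F (leverage x X)) (gaussRows n Sig)) :
    Integrable (fun t => (((n : ℝ) - 1) / (n - p)) * (mahalanobis Sig x / t ^ 2) *
      F (mahalanobis Sig x / t)) (chiSquared (n - p + 1)) ∧
    ∫ X, ‖influence Sig x X‖ ^ 2 * F (leverage x X) ∂(gaussRows n Sig) =
      ∫ t, (((n : ℝ) - 1) / (n - p)) * (mahalanobis Sig x / t ^ 2) * F (mahalanobis Sig x / t)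
        ∂(chiSquared (n - p + 1)) := by
  have hn : (p : ℝ) + 2 ≤ n := by exact_mod_cast hp
  have hp0 : (0 : ℝ) ≤ p := p.cast_nonneg
  have hd := mahalanobis_nonneg hSig x
  have hc : 0 ≤ ((n : ℝ) - 1) / (n - p) := div_nonneg (by linarith) (by linarith)
  have hl : ∀ᵐ X ∂(gaussRows n Sig), 0 ≤ ‖influence Sig x X‖ ^ 2 * F (leverage x X) := by
    filter_upwards [spanning_ae_gaussRows hSig (by lia : p ≤ n)] with X hX
    exact mul_nonneg (sq_nonneg _) (hF0 _ (inner_gramSolve_self_nonneg hX x))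
  have hr : ∀ᵐ t ∂(chiSquared (n - p + 1)), 0 ≤ (((n : ℝ) - 1) / (n - p)) *
      (mahalanobis Sig x / t ^ 2) * F (mahalanobis Sig x / t) := by
    filter_upwards [chiSquared_pos_ae (by lia : 1 ≤ n - p + 1)] with t ht
    exact mul_nonneg (by positivity) (hF0 _ (by positivity))
  have key : ∫⁻ X, ENNReal.ofReal (‖influence Sig x X‖ ^ 2 * F (leverage x X))
      ∂(gaussRows n Sig) = ∫⁻ t, ENNReal.ofReal ((((n : ℝ) - 1) / (n - p)) *
      (mahalanobis Sig x / t ^ 2) * F (mahalanobis Sig x / t)) ∂(chiSquared (n - p + 1)) := by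
    have h := lintegral_norm_sq_gramSolve_gaussRows hSig hp x (F := fun s => ENNReal.ofReal (F s))
      (by fun_prop)
    calc _ = _ := lintegral_congr fun X => ENNReal.ofReal_mul (sq_nonneg _)
      _ = _ := h
      _ = _ := lintegral_congr fun t => (ENNReal.ofReal_mul (by positivity)).symm
  have hmr : Measurable fun t => (((n : ℝ) - 1) / (n - p)) * (mahalanobis Sig x / t ^ 2) *
      F (mahalanobis Sig x / t) := by fun_prop
  refine ⟨⟨hmr.aestronglyMeasurable, ?_⟩, ?_⟩
  · rw [hasFiniteIntegral_iff_ofReal hr, ← key]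
    exact hint.lintegral_lt_top
  · rw [integral_eq_lintegral_of_nonneg_ae hl hint.aestronglyMeasurable,
      integral_eq_lintegral_of_nonneg_ae hr hmr.aestronglyMeasurable, key]

end

end

/-! ### Expected risk before and after adding an observation. -/

section

variable {n p : ℕ}

/-- The prediction risk of the least squares estimator. -/
def risk (P : Measure (Point p)) (S : Fin n → Point p) : ℝ :=
  ∫ z : Point p, (z.2 - inner ℝ z.1 (ridgeEstimator 0 S)) ^ 2 ∂P

namespace IsLinearModel

variable {P : Measure (Point p)} {β : EuclideanSpace ℝ (Fin p)} {σ : ℝ}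
  {Sig : Matrix (Fin p) (Fin p) ℝ}

lemma spanning_inputs_ae (h : IsLinearModel P β σ Sig) (hSig : Sig.PosDef) (hp : p ≤ n) :
    ∀ᵐ S ∂(Measure.pi fun _ : Fin n => P), Spanning (inputs S) :=
  h.measurePreserving_inputs.quasiMeasurePreserving.ae (spanning_ae_gaussRows hSig hp)

/-- The summand `0` is the error-free term `v` of `integral_norm_sq_sum_noise_smul`. -/
lemma risk_eq (h : IsLinearModel P β σ Sig) {S : Fin n → Point p} (hS : Spanning (inputs S)) :
    risk P S = σ ^ 2 + ‖∑ i, noise β (S i) • weight Sig i (inputs S) + 0‖ ^ 2 := by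
  rw [risk, h.integral_sub_inner_sq, ridgeEstimator_zero_sub hS, map_sum, add_zero]
  simp_rw [map_smul]
  rfl

/-- The new point is not random: its error is a constant, so its contribution depends on the inputs
only and plays the role of `v`. -/
lemma risk_snoc_eq (h : IsLinearModel P β σ Sig) {S : Fin n → Point p} (hS : Spanning (inputs S))
    (x : EuclideanSpace ℝ (Fin p)) (y : ℝ) :
    risk P (Fin.snoc S (x, y) : Fin (n + 1) → Point p) =
      σ ^ 2 + ‖∑ i, noise β (S i) • weightInsert Sig x i (inputs S) +
        ((y - inner ℝ x β) / (1 + leverage x (inputs S))) • influence Sig x (inputs S)‖ ^ 2 := by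
  have hS' : Spanning (inputs (Fin.snoc S (x, y) : Fin (n + 1) → Point p)) := by
    rw [inputs_snoc]; exact hS.snoc x
  rw [risk, h.integral_sub_inner_sq, ridgeEstimator_zero_sub hS', Fin.sum_univ_castSucc, inputs_snoc]
  simp only [Fin.snoc_castSucc, Fin.snoc_last]
  rw [gramSolve_snoc_last hS]
  simp_rw [gramSolve_snoc hS, map_add, map_sum, map_smul, map_sub, map_smul]
  rw [smul_smul, mul_one_div]
  rfl

lemma integral_risk (h : IsLinearModel P β σ Sig) (hSig : Sig.PosDef) (hp : p + 2 ≤ n) :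
    Integrable (risk P) (Measure.pi fun _ : Fin n => P) ∧
      ∫ S, risk P S ∂(Measure.pi fun _ : Fin n => P) =
        σ ^ 2 + σ ^ 2 * ∫ X, ∑ i, ‖weight Sig i X‖ ^ 2 ∂(gaussRows n Sig) := by
  have := h.isProbabilityMeasure
  obtain ⟨h1, h2⟩ := h.integral_norm_sq_sum_noise_smul (n := n)
    (fun i => measurable_weight Sig i) (fun i => memLp_weight hSig hp i) (v := fun _ => 0)
    measurable_const (memLp_const 0)
  have hae : risk P =ᵐ[Measure.pi fun _ : Fin n => P]
      fun S => σ ^ 2 + ‖∑ i, noise β (S i) • weight Sig i (inputs S) + 0‖ ^ 2 := by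
    filter_upwards [h.spanning_inputs_ae hSig (by lia : p ≤ n)] with S hS
    exact h.risk_eq hS
  refine ⟨((integrable_const _).add h1).congr hae.symm, ?_⟩
  rw [integral_congr_ae hae, integral_add (integrable_const _) h1, h2, ← integral_const_mul]
  simp

lemma integral_risk_snoc (h : IsLinearModel P β σ Sig) (hSig : Sig.PosDef) (hp : p + 2 ≤ n)
    (x : EuclideanSpace ℝ (Fin p)) (y : ℝ) :
    Integrable (fun S => risk P (Fin.snoc S (x, y) : Fin (n + 1) → Point p))
      (Measure.pi fun _ : Fin n => P) ∧
      ∫ S, risk P (Fin.snoc S (x, y) : Fin (n + 1) → Point p) ∂(Measure.pi fun _ : Fin n => P) =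
        σ ^ 2 + (σ ^ 2 * (∫ X, ∑ i, ‖weight Sig i X‖ ^ 2 ∂(gaussRows n Sig) -
          ∫ X, ‖influence Sig x X‖ ^ 2 * ((2 + leverage x X) / (1 + leverage x X) ^ 2)
            ∂(gaussRows n Sig)) +
          (y - inner ℝ x β) ^ 2 * ∫ X, ‖influence Sig x X‖ ^ 2 * (1 / (1 + leverage x X) ^ 2)
            ∂(gaussRows n Sig)) := by
  have := h.isProbabilityMeasure
  set e : ℝ := y - inner ℝ x β with he
  have hm1 := measurable_leverage (n := n) x
  have hm2 := measurable_influence (n := n) Sig x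
  have hi1 := integrable_sum_norm_sq_weight (n := n) hSig hp
  have hi2 := integrable_norm_sq_influence_mul (n := n) hSig hp x
  have hi3 := integrable_norm_sq_influence_div (n := n) hSig hp x
  have hvm : Measurable fun X : Fin n → EuclideanSpace ℝ (Fin p) =>
      (e / (1 + leverage x X)) • influence Sig x X := by fun_prop
  have hvsq : ∀ X : Fin n → EuclideanSpace ℝ (Fin p),
      ‖(e / (1 + leverage x X)) • influence Sig x X‖ ^ 2 =
        e ^ 2 * (‖influence Sig x X‖ ^ 2 * (1 / (1 + leverage x X) ^ 2)) := by
    intro X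
    rw [norm_smul, mul_pow, Real.norm_eq_abs, sq_abs, div_pow]
    ring
  have hv : MemLp (fun X => (e / (1 + leverage x X)) • influence Sig x X) 2 (gaussRows n Sig) :=
    memLp_two_of_norm_sq_le hvm.aestronglyMeasurable (hi3.const_mul (e ^ 2))
      (.of_forall fun X => (hvsq X).le)
  obtain ⟨h1, h2⟩ := h.integral_norm_sq_sum_noise_smul (n := n)
    (fun i => measurable_weightInsert Sig x i) (fun i => memLp_weightInsert hSig hp x i) hvm hv
  have hae : (fun S => risk P (Fin.snoc S (x, y) : Fin (n + 1) → Point p))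
      =ᵐ[Measure.pi fun _ : Fin n => P] fun S => σ ^ 2 +
        ‖∑ i, noise β (S i) • weightInsert Sig x i (inputs S) +
        (e / (1 + leverage x (inputs S))) • influence Sig x (inputs S)‖ ^ 2 := by
    filter_upwards [h.spanning_inputs_ae hSig (by lia : p ≤ n)] with S hS
    exact h.risk_snoc_eq hS x y
  refine ⟨((integrable_const _).add h1).congr hae.symm, ?_⟩
  have hae2 : (fun X => σ ^ 2 * ∑ i, ‖weightInsert Sig x i X‖ ^ 2 +
      ‖(e / (1 + leverage x X)) • influence Sig x X‖ ^ 2) =ᵐ[gaussRows n Sig]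
      fun X => σ ^ 2 * (∑ i, ‖weight Sig i X‖ ^ 2 -
        ‖influence Sig x X‖ ^ 2 * ((2 + leverage x X) / (1 + leverage x X) ^ 2)) +
        e ^ 2 * (‖influence Sig x X‖ ^ 2 * (1 / (1 + leverage x X) ^ 2)) := by
    filter_upwards [spanning_ae_gaussRows hSig (by lia : p ≤ n)] with X hX
    rw [hvsq, sum_norm_sq_weightInsert hX]
  have hi12 : Integrable (fun X => ∑ i, ‖weight Sig i X‖ ^ 2 -
      ‖influence Sig x X‖ ^ 2 * ((2 + leverage x X) / (1 + leverage x X) ^ 2)) (gaussRows n Sig) :=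
    hi1.sub hi2
  rw [integral_congr_ae hae, integral_add (integrable_const _) h1, h2, integral_congr_ae hae2,
    integral_add (hi12.const_mul _) (hi3.const_mul _), integral_const_mul, integral_const_mul,
    integral_sub hi1 hi2]
  simp

end IsLinearModel

/-- The variable whose expectation under a chi-squared law is the expected effect of a new
observation, with squared Mahalanobis norm `d` and squared error `s`, on the risk, up to a
constant. -/
def effect (n p : ℕ) (σ d s t : ℝ) : ℝ :=
  (((n : ℝ) - 1) / ((n : ℝ) - p)) * ((d * s + t * σ ^ 2) / (d + t) ^ 2)

/-- The part of the expected reduction of the risk that is common to all points. -/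
def baseline (n p : ℕ) (σ : ℝ) : ℝ :=
  ∫ t : ℝ, (((n : ℝ) - 1) / ((n : ℝ) - p)) * (σ ^ 2 * (1 / t)) ∂(chiSquared (n - p + 1))

/-- The expected reduction of the risk when an observation is added. -/
lemma IsLinearModel.integral_risk_sub {P : Measure (Point p)} {β : EuclideanSpace ℝ (Fin p)} {σ : ℝ}
    {Sig : Matrix (Fin p) (Fin p) ℝ} (h : IsLinearModel P β σ Sig) (hSig : Sig.PosDef)
    (hp : p + 2 ≤ n) (x : EuclideanSpace ℝ (Fin p)) (y : ℝ) :
    Integrable (effect n p σ (mahalanobis Sig x) ((y - inner ℝ x β) ^ 2))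
      (chiSquared (n - p + 1)) ∧
    ∫ S, risk P S ∂(Measure.pi fun _ : Fin n => P) -
      ∫ S, risk P (Fin.snoc S (x, y) : Fin (n + 1) → Point p) ∂(Measure.pi fun _ : Fin n => P) =
        baseline n p σ - ∫ t, effect n p σ (mahalanobis Sig x) ((y - inner ℝ x β) ^ 2) t
          ∂(chiSquared (n - p + 1)) := by
  rw [(h.integral_risk hSig hp).2, (h.integral_risk_snoc hSig hp x y).2]
  obtain ⟨i1, e1⟩ := integral_norm_sq_influence_mul hSig hp x
    (F := fun s => (2 + s) / (1 + s) ^ 2) (by fun_prop) (fun s hs => by positivity)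
    (integrable_norm_sq_influence_mul hSig hp x)
  obtain ⟨i2, e2⟩ := integral_norm_sq_influence_mul hSig hp x
    (F := fun s => 1 / (1 + s) ^ 2) (by fun_prop) (fun s hs => by positivity)
    (integrable_norm_sq_influence_div hSig hp x)
  have hd := mahalanobis_nonneg hSig x
  set d := mahalanobis Sig x
  set s : ℝ := (y - inner ℝ x β) ^ 2
  set c : ℝ := ((n : ℝ) - 1) / (n - p) with hc
  have i0 : Integrable (fun t => c * (σ ^ 2 * (1 / t))) (chiSquared (n - p + 1)) :=
    ((integrable_inv_chiSquared (by lia)).const_mul _).const_mul _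
  have i1' := i1.const_mul (σ ^ 2)
  have i2' := i2.const_mul s
  have i12 : Integrable (fun t => σ ^ 2 * (c * (d / t ^ 2) * ((2 + d / t) / (1 + d / t) ^ 2)) -
      s * (c * (d / t ^ 2) * (1 / (1 + d / t) ^ 2))) (chiSquared (n - p + 1)) := i1'.sub i2'
  -- Partial fractions: `d (2 t + d) / (t (d + t)²) = 1 / t - t / (d + t)²`. The term `1 / t` does
  -- not involve the point and becomes `baseline`.
  have hae : effect n p σ d s =ᵐ[chiSquared (n - p + 1)]
      fun t => c * (σ ^ 2 * (1 / t)) - (σ ^ 2 * (c * (d / t ^ 2) * ((2 + d / t) / (1 + d / t) ^ 2)) -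
        s * (c * (d / t ^ 2) * (1 / (1 + d / t) ^ 2))) := by
    filter_upwards [chiSquared_pos_ae (by lia : 1 ≤ n - p + 1)] with t ht
    rw [effect, ← hc]
    have h1 : 1 + d / t ≠ 0 := by positivity
    have h2 : d + t ≠ 0 := by positivity
    have h3 : 1 + d / t = (d + t) / t := by field_simp; ring
    rw [h3]
    field_simp
    ring
  refine ⟨(i0.sub i12).congr hae.symm, ?_⟩
  have j0 : baseline n p σ = ∫ t, c * (σ ^ 2 * (1 / t)) ∂(chiSquared (n - p + 1)) := rfl
  have j1 := integral_const_mul (μ := chiSquared (n - p + 1)) (σ ^ 2)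
    fun t => c * (d / t ^ 2) * ((2 + d / t) / (1 + d / t) ^ 2)
  have j2 := integral_const_mul (μ := chiSquared (n - p + 1)) s
    fun t => c * (d / t ^ 2) * (1 / (1 + d / t) ^ 2)
  rw [integral_congr_ae hae, integral_sub i0 i12, integral_sub i1' i2', j1, j2, ← j0, e1, e2]
  ring

end

/-! ### The distributional Shapley value as an average of expected marginal contributions -/

/-- A subset that avoids the last index reads only the random points, each at most once, so the
selected points are again i.i.d. -/
lemma exists_snoc_comp_orderEmbOfFin {Z : Type*} {k : ℕ} {S : Finset (Fin (k + 1))}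
    (hS : S ⊆ Finset.univ.erase (Fin.last k)) :
    ∃ g : Fin S.card → Fin k, Function.Injective g ∧ ∀ (B : Fin k → Z) (z : Z),
      (Fin.snoc B z : Fin (k + 1) → Z) ∘ S.orderEmbOfFin rfl = fun i => B (g i) := by
  have hne : ∀ i, S.orderEmbOfFin rfl i ≠ Fin.last k := fun i =>
    Finset.ne_of_mem_erase (hS (S.orderEmbOfFin_mem rfl i))
  refine ⟨fun i => (S.orderEmbOfFin rfl i).castPred (hne i), fun i j hij => ?_, fun B z => ?_⟩
  · exact (S.orderEmbOfFin rfl).injective (Fin.castPred_inj.1 hij)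
  · funext i
    rw [Function.comp_apply, ← Fin.castSucc_castPred _ (hne i), Fin.snoc_castSucc]

section

variable {Z : Type*} [MeasurableSpace Z] {P : Measure Z} [IsProbabilityMeasure P]

variable (P) in
lemma measurePreserving_comp_injective {ι κ : Type*} [Fintype ι] [Fintype κ] {g : ι → κ}
    (hg : Function.Injective g) :
    MeasurePreserving (fun (B : κ → Z) i => B (g i)) (Measure.pi fun _ : κ => P)
      (Measure.pi fun _ : ι => P) := by
  refine ⟨by fun_prop, ?_⟩
  have h1 : iIndepFun (fun (k : κ) (B : κ → Z) => B k) (Measure.pi fun _ : κ => P) :=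
    iIndepFun_pi (X := fun _ => id) fun _ => aemeasurable_id
  have h2 := (iIndepFun_iff_map_fun_eq_pi_map
    (fun i => (measurable_pi_apply (g i)).aemeasurable)).1 (h1.precomp hg)
  rw [h2]
  congr 1
  funext i
  exact (measurePreserving_eval (fun _ : κ => P) (g i)).map_eq

lemma integral_marginal_orderEmbOfFin {U : Utility Z} {z : Z} {k : ℕ} {S : Finset (Fin (k + 1))}
    (hS : S ⊆ Finset.univ.erase (Fin.last k))
    (hint : Integrable (fun T : Fin S.card → Z => marginal U z T) (Measure.pi fun _ => P)) :
    Integrable (fun B : Fin k → Z =>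
      marginal U z ((Fin.snoc B z : Fin (k + 1) → Z) ∘ S.orderEmbOfFin rfl))
        (Measure.pi fun _ => P) ∧
    ∫ B : Fin k → Z, marginal U z ((Fin.snoc B z : Fin (k + 1) → Z) ∘ S.orderEmbOfFin rfl)
        ∂(Measure.pi fun _ => P) =
      ∫ T : Fin S.card → Z, marginal U z T ∂(Measure.pi fun _ => P) := by
  obtain ⟨g, hg, hB⟩ := exists_snoc_comp_orderEmbOfFin (Z := Z) hS
  simp_rw [hB]
  have hmp := measurePreserving_comp_injective P hg
  refine ⟨hmp.integrable_comp_of_integrable hint, ?_⟩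
  conv_rhs => rw [← hmp.map_eq]
  rw [integral_map hmp.aemeasurable]
  rw [hmp.map_eq]
  exact hint.aestronglyMeasurable

/-- All subsets of one size have the same expected marginal contribution, and their number cancels
the binomial weight. -/
lemma integral_dataShapleyInsert {U : Utility Z} {z : Z} {k : ℕ}
    (hint : ∀ n ≤ k, Integrable (fun T : Fin n → Z => marginal U z T) (Measure.pi fun _ => P)) :
    Integrable (fun B : Fin k → Z => dataShapleyInsert U z B) (Measure.pi fun _ => P) ∧
    ∫ B : Fin k → Z, dataShapleyInsert U z B ∂(Measure.pi fun _ => P) =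
      (1 / ((k + 1 : ℕ) : ℝ)) * ∑ n ∈ Finset.range (k + 1),
        ∫ T : Fin n → Z, marginal U z T ∂(Measure.pi fun _ => P) := by
  have hmem : ∀ j ∈ Finset.Icc 1 (k + 1),
      ∀ S ∈ Finset.powersetCard (j - 1) (Finset.univ.erase (Fin.last k)),
      Integrable (fun B : Fin k → Z =>
        marginal U z ((Fin.snoc B z : Fin (k + 1) → Z) ∘ S.orderEmbOfFin rfl))
          (Measure.pi fun _ => P) ∧
      ∫ B : Fin k → Z, marginal U z ((Fin.snoc B z : Fin (k + 1) → Z) ∘ S.orderEmbOfFin rfl)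
          ∂(Measure.pi fun _ => P) =
        ∫ T : Fin (j - 1) → Z, marginal U z T ∂(Measure.pi fun _ => P) := by
    intro j hj S hS
    obtain ⟨hS, hc⟩ := Finset.mem_powersetCard.1 hS
    have hj' := Finset.mem_Icc.1 hj
    have h := integral_marginal_orderEmbOfFin (U := U) (z := z) hS (hint _ (by lia))
    rw [← hc]
    exact h
  simp only [dataShapleyInsert, dataShapley, Fin.snoc_last]
  have hI : ∀ j ∈ Finset.Icc 1 (k + 1), Integrable (fun B : Fin k → Z =>
      (1 / ((k + 1 - 1).choose (j - 1) : ℝ)) *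
      ∑ S ∈ Finset.powersetCard (j - 1) (Finset.univ.erase (Fin.last k)),
        marginal U z ((Fin.snoc B z : Fin (k + 1) → Z) ∘ S.orderEmbOfFin rfl))
      (Measure.pi fun _ => P) := fun j hj =>
    (integrable_finsetSum _ fun S hS => (hmem j hj S hS).1).const_mul _
  refine ⟨(integrable_finsetSum _ hI).const_mul _, ?_⟩
  rw [integral_const_mul, integral_finsetSum _ hI]
  congr 1
  -- Position `j` of the new point corresponds to `n = j - 1` points before it.
  refine Finset.sum_nbij' (· - 1) (· + 1) (fun j hj => ?_) (fun j hj => ?_) (fun j hj => ?_)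
    (fun j hj => ?_) (fun j hj => ?_)
  · have := Finset.mem_Icc.1 hj
    exact Finset.mem_range.2 (by lia)
  · have := Finset.mem_range.1 hj
    exact Finset.mem_Icc.2 (by lia)
  · have := Finset.mem_Icc.1 hj
    lia
  · simp
  · have hj' := Finset.mem_Icc.1 hj
    rw [integral_const_mul, integral_finsetSum _ fun S hS => (hmem j hj S hS).1,
      Finset.sum_congr rfl fun S hS => (hmem j hj S hS).2, Finset.sum_const,
      Finset.card_powersetCard, Finset.card_erase_of_mem (Finset.mem_univ _), Finset.card_univ,
      Fintype.card_fin, nsmul_eq_mul, ← mul_assoc, one_div_mul_cancel, one_mul]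
    exact_mod_cast (Nat.choose_pos (by lia)).ne'

end

/-! ### The main theorem -/

section

variable {p : ℕ} {P : Measure (Point p)} {β : EuclideanSpace ℝ (Fin p)} {σ : ℝ}
  {Sig : Matrix (Fin p) (Fin p) ℝ}

/-- The expected marginal contribution of an observation. -/
lemma IsLinearModel.integral_marginal (h : IsLinearModel P β σ Sig) (hSig : Sig.PosDef) {q : ℕ}
    (hq : p + 3 ≤ q) (C : ℝ) (x : EuclideanSpace ℝ (Fin p)) (y : ℝ) (n : ℕ) :
    Integrable (fun S : Fin n → Point p => marginal (ridgeUtility P C q 0) (x, y) S)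
      (Measure.pi fun _ => P) ∧
    ∫ S : Fin n → Point p, marginal (ridgeUtility P C q 0) (x, y) S ∂(Measure.pi fun _ => P) =
      if q - 1 ≤ n then
        (if n = q - 1 then C - ∫ S, risk P S ∂(Measure.pi fun _ : Fin (q - 1) => P) else 0) +
        (baseline n p σ - ∫ t, effect n p σ (mahalanobis Sig x) ((y - inner ℝ x β) ^ 2) t
          ∂(chiSquared (n - p + 1)))
      else 0 := by
  have := h.isProbabilityMeasure
  have hm : ∀ S : Fin n → Point p, marginal (ridgeUtility P C q 0) (x, y) S =
      (if q ≤ n + 1 then C - risk P (Fin.snoc S (x, y) : Fin (n + 1) → Point p) else 0) -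
      (if q ≤ n then C - risk P S else 0) := fun S => rfl
  simp_rw [hm]
  by_cases hn : q - 1 ≤ n
  · obtain ⟨i1, -⟩ := h.integral_risk (n := n) hSig (by lia)
    obtain ⟨i2, -⟩ := h.integral_risk_snoc (n := n) hSig (by lia) x y
    have hsub := (h.integral_risk_sub (n := n) hSig (by lia) x y).2
    rw [if_pos hn, ← hsub]
    simp only [if_pos (by lia : q ≤ n + 1)]
    -- At `n = q - 1` the utility jumps from `0` to `C` minus a risk. Relative to the generic drop
    -- of the risk this leaves the excess `C` minus the expected risk of `q - 1` points.
    by_cases hn' : n = q - 1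
    · subst hn'
      simp only [if_neg (by lia : ¬ q ≤ q - 1), if_true, sub_zero]
      refine ⟨(integrable_const C).sub i2, ?_⟩
      rw [integral_sub (integrable_const C) i2]
      simp
    · simp only [if_pos (by lia : q ≤ n), if_neg hn', sub_sub_sub_cancel_left, zero_add]
      exact ⟨i1.sub i2, integral_sub i1 i2⟩
  · simp [if_neg (by lia : ¬ q ≤ n + 1), if_neg (by lia : ¬ q ≤ n), hn]

/-- The constant for which the distributional Shapley value has no term common to all points. -/
def utilityConst (P : Measure (Point p)) (σ : ℝ) (q m : ℕ) : ℝ :=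
  ∫ S, risk P S ∂(Measure.pi fun _ : Fin (q - 1) => P) -
    ∑ n ∈ Finset.Icc (q - 1) (m - 1), baseline n p σ

lemma IsLinearModel.dShapley_eq (h : IsLinearModel P β σ Sig) (hSig : Sig.PosDef) {q m : ℕ}
    (hq : p + 3 ≤ q) (hm : 1 ≤ m) (x : EuclideanSpace ℝ (Fin p)) (y : ℝ) :
    Integrable (fun B : Fin (m - 1) → Point p =>
      dataShapleyInsert (ridgeUtility P (utilityConst P σ q m) q 0) (x, y) B)
        (Measure.pi fun _ => P) ∧
    dShapley (ridgeUtility P (utilityConst P σ q m) q 0) P m (x, y) =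
      -(1 / (m : ℝ)) * ∑ n ∈ Finset.Icc (q - 1) (m - 1),
        ∫ t, effect n p σ (mahalanobis Sig x) ((y - inner ℝ x β) ^ 2) t
          ∂(chiSquared (n - p + 1)) := by
  have := h.isProbabilityMeasure
  obtain ⟨k, rfl⟩ : ∃ k, m = k + 1 := ⟨m - 1, by lia⟩
  simp only [dShapley, Nat.add_sub_cancel]
  set C := utilityConst P σ q (k + 1) with hC
  obtain ⟨h1, h2⟩ := integral_dataShapleyInsert (P := P) (U := ridgeUtility P C q 0) (z := (x, y))
    (k := k) fun n _ => (h.integral_marginal hSig hq C x y n).1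
  refine ⟨h1, ?_⟩
  have hfilter : (Finset.range (k + 1)).filter (fun n => q - 1 ≤ n) = Finset.Icc (q - 1) k := by
    ext n
    simp only [Finset.mem_filter, Finset.mem_range, Finset.mem_Icc]
    lia
  refine h2.trans ?_
  rw [Finset.sum_congr rfl fun n _ => (h.integral_marginal hSig hq C x y n).2,
    ← Finset.sum_filter, hfilter, Finset.sum_add_distrib, Finset.sum_sub_distrib,
    Finset.sum_ite_eq']
  -- The excess at `n = q - 1` occurs once and cancels the sum of the baselines by the choice of the
  -- constant. If `q - 1 > k`, no data set reaches the threshold and both sides vanish.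
  by_cases hqk : q - 1 ≤ k
  · rw [if_pos (Finset.mem_Icc.2 ⟨le_rfl, hqk⟩), hC, utilityConst, Nat.add_sub_cancel]
    ring
  · rw [Finset.Icc_eq_empty (by lia)]
    simp

end

end DShapley
end

theorem theorem1 {Ω : Type*} [MeasurableSpace Ω] (μ : Measure Ω) [IsProbabilityMeasure μ]
    (p q m : ℕ) (hq : p + 3 ≤ q) (hm : 1 ≤ m)
    (X : Ω → EuclideanSpace ℝ (Fin p)) (Y : Ω → ℝ)
    (hX : Measurable X) (hY : MemLp Y 2 μ)
    (β : EuclideanSpace ℝ (Fin p)) (σ : ℝ)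
    (Sig : Matrix (Fin p) (Fin p) ℝ) (hSig : Sig.PosDef)
    (hXlaw : μ.map X = multivariateGaussian 0 Sig)
    (hmean : μ[Y | MeasurableSpace.comap X inferInstance] =ᵐ[μ] fun ω => inner ℝ (X ω) β)
    (hvar : condVar (MeasurableSpace.comap X inferInstance) Y μ =ᵐ[μ] fun _ => σ ^ 2)
    (P : Measure (DShapley.Point p)) (hP : P = μ.map fun ω => (X ω, Y ω)) :
    ∃ C : ℝ,
      (∀ (x : EuclideanSpace ℝ (Fin p)) (y : ℝ),
        Integrable
          (fun B : Fin (m - 1) → DShapley.Point p =>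
            DShapley.dataShapleyInsert (DShapley.ridgeUtility P C q 0) (x, y) B)
          (Measure.pi fun _ => P) ∧
        (∀ j ∈ Finset.Icc (q - 1) (m - 1),
          Integrable
            (fun t : ℝ => (((j : ℝ) - 1) / ((j : ℝ) - p)) *
              ((DShapley.mahalanobis Sig x * (y - inner ℝ x β) ^ 2 + t * σ ^ 2) /
                (DShapley.mahalanobis Sig x + t) ^ 2))
            (DShapley.chiSquared (j - p + 1))) ∧
        DShapley.dShapley (DShapley.ridgeUtility P C q 0) P m (x, y) =
          -(1 / (m : ℝ)) * ∑ j ∈ Finset.Icc (q - 1) (m - 1),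
            ∫ t : ℝ, (((j : ℝ) - 1) / ((j : ℝ) - p)) *
              ((DShapley.mahalanobis Sig x * (y - inner ℝ x β) ^ 2 + t * σ ^ 2) /
                (DShapley.mahalanobis Sig x + t) ^ 2) ∂(DShapley.chiSquared (j - p + 1))) ∧
      (∀ (x₁ x₂ : EuclideanSpace ℝ (Fin p)) (y₁ y₂ : ℝ),
        DShapley.mahalanobis Sig x₁ = DShapley.mahalanobis Sig x₂ →
        (y₁ - inner ℝ x₁ β) ^ 2 = (y₂ - inner ℝ x₂ β) ^ 2 →
        DShapley.dShapley (DShapley.ridgeUtility P C q 0) P m (x₁, y₁) =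
          DShapley.dShapley (DShapley.ridgeUtility P C q 0) P m (x₂, y₂)) := by
  subst hP
  have h := DShapley.isLinearModel_map hX hY hXlaw hmean hvar
  refine ⟨DShapley.utilityConst (μ.map fun ω => (X ω, Y ω)) σ q m, fun x y => ?_,
    fun x₁ x₂ y₁ y₂ hd hs => ?_⟩
  · obtain ⟨h1, h2⟩ := h.dShapley_eq hSig hq hm x y
    refine ⟨h1, fun j hj => ?_, h2⟩
    have hj' := Finset.mem_Icc.1 hj
    exact (h.integral_risk_sub hSig (by lia : p + 2 ≤ j) x y).1
  · rw [(h.dShapley_eq hSig hq hm x₁ y₁).2, (h.dShapley_eq hSig hq hm x₂ y₂).2, hd, hs]
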